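/- Let $\mathbb T$ be the unit circle with normalized Lebesgue measure $d\mathbf m$, and let $\mathbb H^2_+(\mathbb T)\subset L^2(\mathbb T)$ be the Hardy space of functions whose Fourier coefficients with negative index vanish. A bounded operator $\mathbf G$ on $\mathbb H^2_+(\mathbb T)$ is called the Hankel operator with symbol $\sigma\in L^\infty(\mathbb T)$ if $$(\mathbf G u,u)=\int_{\mathbb T}\sigma(\mu)\,u(\bar\mu)\,\overline{u(\mu)}\,d\mathbf m(\mu)\qquad\text{for all }u\in\mathbb H^2_+(\mathbb T).$$ Let $$\omega(\zeta)=R_1(\zeta)+\sum_{m=2}^{M}R_m(\zeta)\,(\zeta-\gamma_m)^{-K_m-1},$$ where $M\ge 1$, $\gamma_2,\dots,\gamma_M\in\mathbb C$ are pairwise distinct, $|\gamma_m|>1$, $K_m\in\mathbb Z_+$, $R_1,\dots,R_M$ are complex polynomials, and $\deg R_m\le K_m$, $R_m(\gamma_m)\ne 0$ for $m\ge 2$. If $R_1\neq0$, put $K_1=\deg R_1$. Let $\mathbf G$ be the Hankel operator on $\mathbb H^2_+(\mathbb T)$ with symbol $\pi i\,\mu^{-1}\operatorname{sgn}\operatorname{Im}\mu+\omega(\mu)$,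 and suppose that $\mathbf G$ is self-adjoint. Put $\mathsf p_1=R_1^{(K_1)}$ if $R_1\ne0$, and $\mathsf p_m=-R_m(\gamma_m)\operatorname{sgn}\gamma_m$ for those $m\ge2$ with $\gamma_m$ real (these numbers are real and non-zero because $\mathbf G$ is self-adjoint). For these $m$ let $$\mathcal N_-^{(m)}=\begin{cases}(K_m+1)/2,& K_m\text{ odd},\\ K_m/2,& K_m\text{ even and }\mathsf p_m>0,\\ K_m/2+1,& K_m\text{ even and }\mathsf p_m<0,\end{cases}$$ and put $\mathcal N_-^{(1)}=0$ if $R_1=0$. Then the part of the spectrum of $\mathbf G$ in $(-\infty,0)$ consists of eigenvalues, and the total number $N_-(\mathbf G)$ of strictly negative eigenvalues, counted with multiplicity, is finite and equals $$N_-(\mathbf G)=\mathcal N_-^{(1)}+\sum_{m\ge2,\ \operatorname{Im}\gamma_m=0}\mathcal N_-^{(m)}+\sum_{m\ge2,\ \operatorname{Im}\gamma_m<0}K_m+M_1,$$ where $M_1$ is the number of indices $m\ge2$ with $\operatorname{Im}\gamma_m<0$. -/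

import Mathlib

open MeasureTheory

/-- The Hardy space `H²₊(𝕋)`: the functions of `L²(𝕋)`, with respect to the normalized Lebesgue
measure, whose Fourier coefficients with negative index vanish. The unit circle is parametrized
by `t ↦ μ = exp (2 π i t) = AddCircle.toCircle t`, so that complex conjugation `μ ↦ μ̄` is
`t ↦ -t`. -/
def hardySpace :
    Submodule ℂ (Lp ℂ 2 (AddCircle.haarAddCircle : Measure UnitAddCircle)) where
  carrier := {u | ∀ n : ℤ, n < 0 → fourierCoeff (u : UnitAddCircle → ℂ) n = 0}
  zero_mem' n _ := by
    rw [← fourierBasis_repr]; simp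
  add_mem' {u v} hu hv n hn := by
    have h1 := hu n hn
    have h2 := hv n hn
    rw [← fourierBasis_repr] at h1 h2 ⊢
    simp [h1, h2]
  smul_mem' c u hu n hn := by
    have h1 := hu n hn
    rw [← fourierBasis_repr] at h1 ⊢
    simp [h1]

theorem isClosed_hardySpace :
    IsClosed (hardySpace : Set (Lp ℂ 2 (AddCircle.haarAddCircle : Measure UnitAddCircle))) := by
  have h : (hardySpace : Set (Lp ℂ 2 (AddCircle.haarAddCircle : Measure UnitAddCircle))) =
      ⋂ n : ℤ, ⋂ _ : n < 0, {u | inner ℂ (fourierBasis n) u = 0} := by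
    ext u
    simp only [SetLike.mem_coe, Set.mem_iInter, Set.mem_ofPred_eq, ← HilbertBasis.repr_apply_apply,
      fourierBasis_repr]
    rfl
  rw [h]
  exact isClosed_iInter fun n => isClosed_iInter fun _ =>
    isClosed_eq (by fun_prop) continuous_const

instance instCompleteSpaceHardySpace : CompleteSpace hardySpace :=
  isClosed_hardySpace.completeSpace_coe

/-- `G` is the Hankel operator on `H²₊(𝕋)` with (essentially bounded) symbol `ω`:
`(G u, u) = ∫_𝕋 ω(μ) u(μ̄) conj(u(μ)) dm(μ)` for all `u`. Mathlib's inner product is linear in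
its second argument. -/
structure IsHankelOperator (G : hardySpace →L[ℂ] hardySpace) (ω : Circle → ℂ) : Prop where
  memLp_symbol :
    MemLp (fun t : UnitAddCircle => ω (AddCircle.toCircle t)) ⊤ AddCircle.haarAddCircle
  inner_eq : ∀ u : hardySpace,
    inner ℂ u (G u) =
      ∫ t : UnitAddCircle,
        ω (AddCircle.toCircle t) * (u : Lp ℂ 2 AddCircle.haarAddCircle) (-t) *
          (starRingEnd ℂ) ((u : Lp ℂ 2 AddCircle.haarAddCircle) t)
        ∂AddCircle.haarAddCircle

/-- The symbol `π i μ⁻¹ sgn (Im μ)` of the Carleman operator. -/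
noncomputable def carlemanSymbol (μ : Circle) : ℂ :=
  (Real.pi : ℂ) * Complex.I * (μ : ℂ)⁻¹ * (Real.sign (μ : ℂ).im : ℂ)

/-- The rational function `R₁(ζ) + ∑ₘ Rₘ(ζ) (ζ - γₘ) ^ (-Kₘ - 1)`. -/
noncomputable def rationalSymbol (R₁ : Polynomial ℂ) {n : ℕ} (γ : Fin n → ℂ) (K : Fin n → ℕ)
    (R : Fin n → Polynomial ℂ) (ζ : ℂ) : ℂ :=
  R₁.eval ζ + ∑ m, (R m).eval ζ / (ζ - γ m) ^ (K m + 1)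

/-- The number `𝒩₋` of negative eigenvalues attached to a real term of degree `K` with
(nonzero) top coefficient `p`. -/
noncomputable def negCount (K : ℕ) (p : ℝ) : ℕ :=
  if Odd K then (K + 1) / 2 else if 0 < p then K / 2 else K / 2 + 1

/-- The span of all eigenvectors of `G` with a strictly negative eigenvalue. For self-adjoint `G`
it is the orthogonal sum of the corresponding eigenspaces, so its dimension is the
total number of negative eigenvalues, counted with multiplicity. -/
noncomputable def negEigenspace {H : Type*} [NormedAddCommGroup H] [InnerProductSpace ℂ H]
    (G : H →L[ℂ] H) : Submodule ℂ H :=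
  ⨆ t : ℝ, ⨆ _ : t < 0, Module.End.eigenspace (G : H →ₗ[ℂ] H) (t : ℂ)

/-! On polynomials `u` the form is `(G u, u) = ∫_{-1}^{1} |u|² dx + Λ(u u*)`, where `u*` has
conjugate coefficients and `Λ f = ∫ ω(μ) f(μ̄) dm`. The integral comes from the Carleman symbol,
whose moments are those of Lebesgue measure on `(-1, 1)`. The functional `Λ` is a sum of jets: order
`Kₘ` at each node `1/γₘ`, order `K₁` at `0` if `R₁ ≠ 0`, all with nonzero leading coefficients.
Self-adjointness makes `Λ` real, so the nodes come in conjugate pairs.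

Let `N` be the asserted count. Prescribed vanishing at the nodes, `N` conditions in all, makes `Λ(u
u*)` nonnegative (`re_nonneg_of_negMultiplicity`), and the integral only helps. Hence there are at
most `N` negative eigenvalues.

Conversely, `Λ(u u*)` is nonpositive on an `N`-dimensional space of polynomials modulo the radical
ideal `(q)` of `Λ` (`re_nonpos_of_sub_negMultiplicity`). Being nondegenerate modulo `(q)`, it is
strictly negative on a space of dimension at least `N`. Adding multiples of `q` does not change `Λ(u
u*)`, while `(q)` is dense in `L²(-1, 1)`, so the integral can be made negligible
(`exists_polyComb_neg`): the Carleman part does not lower the count.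

`negative_spectrum_of_dense_sup` turns the two bounds into the spectral statement, and
`negative_spectrum_of_nodal` assembles them. -/

/-! ### Variational counting of negative eigenvalues -/

section NegativeSpectrum

variable {H : Type*} [NormedAddCommGroup H] [InnerProductSpace ℂ H]

theorem Submodule.isCompactOperator_starProjection (E : Submodule ℂ H) [FiniteDimensional ℂ E] :
    IsCompactOperator E.starProjection := by
  have h : IsCompactOperator E.orthogonalProjectionOnto :=
    isCompactOperator_of_locallyCompactSpace_dom E.orthogonalProjectionOnto
  exact h.clm_comp E.subtypeL

/-- An operator which is bounded below by `0` on a subspace of finite codimension has only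
eigenvalues as spectrum below `0`. -/
theorem hasEigenvalue_of_mem_spectrum_of_neg [CompleteSpace H] {G : H →L[ℂ] H}
    {E : Submodule ℂ H} [FiniteDimensional ℂ E]
    (hE : ∀ u ∈ Eᗮ, 0 ≤ (inner ℂ u (G u)).re) {t : ℝ} (ht : t < 0)
    (hspec : (t : ℂ) ∈ spectrum ℂ G) :
    Module.End.HasEigenvalue (G : H →ₗ[ℂ] H) (t : ℂ) := by
  by_contra hne
  set P := E.starProjection
  set Q := Eᗮ.starProjection
  have hPQ : ∀ x, P x + Q x = x := fun x => E.starProjection_add_starProjection_orthogonal x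
  -- `G - t = B + F`: `B` is coercive with constant `-t`, because `Q G Q` has nonnegative real part,
  -- and `F` is compact because `P` has finite rank.
  set B : H →L[ℂ] H := Q ∘L G ∘L Q - (t : ℂ) • 1 with hB
  set F : H →L[ℂ] H := P ∘L G + Q ∘L G ∘L P with hF
  have hsum : ∀ x, G x - (t : ℂ) • x = B x + F x := fun x => by
    have h1 : G x = G (P x) + G (Q x) := by rw [← map_add, hPQ]
    have h2 := hPQ (G x)
    have h3 : Q (G x) = Q (G (P x)) + Q (G (Q x)) := by rw [h1, map_add]
    simp only [hB, hF, sub_apply, add_apply,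
      ContinuousLinearMap.comp_apply, smul_apply,
      one_apply_eq_self]
    have h4 : G x = P (G x) + (Q (G (P x)) + Q (G (Q x))) := by rw [← h3, h2]
    nth_rw 1 [h4]
    abel
  have hFc : IsCompactOperator F := by
    have hP := E.isCompactOperator_starProjection
    have := (hP.comp_clm G).add (hP.clm_comp (Q ∘L G))
    exact this
  have hBu : IsUnit B := by
    refine B.isUnit_of_forall_le_norm_inner_map (c := Real.toNNReal (-t)) (by simpa using ht) fun x => ?_
    refine le_trans ?_ (Complex.abs_re_le_norm _)
    refine le_trans ?_ (le_abs_self _)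
    have h1 : inner ℂ (B x) x = inner ℂ (G (Q x)) (Q x) - (t : ℂ) * inner ℂ x x := by
      simp only [hB, sub_apply, ContinuousLinearMap.comp_apply,
        smul_apply, one_apply_eq_self, inner_sub_left,
        inner_smul_left, Complex.conj_ofReal]
      rw [show inner ℂ (Q (G (Q x))) x = inner ℂ (G (Q x)) (Q x) from
        Submodule.inner_starProjection_left_eq_right _ _ _]
    have h2 := hE (Q x) (Eᗮ.starProjection_apply_mem x)
    rw [h1, Complex.sub_re, Complex.re_ofReal_mul, ← inner_conj_symm, Complex.conj_re]
    have h3 : (inner ℂ x x).re = ‖x‖ ^ 2 := inner_self_eq_norm_sq (𝕜 := ℂ) x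
    rw [h3]
    rw [Real.coe_toNNReal _ (by linarith)]
    linarith
  obtain ⟨b, hb⟩ := hBu
  set C : H →L[ℂ] H := (↑b⁻¹ : H →L[ℂ] H)
  have hBC : ∀ x, B (C x) = x := fun x => by
    rw [← hb]
    exact congrArg (fun T : H →L[ℂ] H => T x) b.mul_inv
  have hCc : IsCompactOperator (C ∘L F) := hFc.clm_comp C
  -- Fredholm alternative for `G - t = B (1 + B⁻¹ F)`.
  rcases hCc.hasEigenvalue_or_mem_resolventSet (μ := (-1 : ℂ)) (by norm_num) with h | h
  · obtain ⟨v, hv, hv0⟩ := h.exists_hasEigenvector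
    rw [Module.End.mem_eigenspace_iff] at hv
    have h4 : F v = - B v := by
      have := congrArg B hv
      simpa [hBC] using this
    apply hne
    refine Module.End.hasEigenvalue_of_hasEigenvector (x := v) ⟨?_, hv0⟩
    rw [Module.End.mem_eigenspace_iff]
    have := hsum v
    rw [h4, add_neg_cancel, sub_eq_zero] at this
    exact this
  · rw [spectrum.mem_resolventSet_iff] at h
    apply hspec
    rw [spectrum.mem_resolventSet_iff]
    have h5 : algebraMap ℂ (H →L[ℂ] H) t - G = B * (algebraMap ℂ (H →L[ℂ] H) (-1) - C ∘L F) := by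
      ext x
      have := hsum x
      simp [Algebra.algebraMap_eq_smul_one, hBC] at this ⊢
      rw [← neg_sub (G x), this]
      abel
    rw [h5]
    exact (hb ▸ b.isUnit).mul h

theorem negEigenspace_le_iff {G : H →L[ℂ] H} {S : Submodule ℂ H} :
    negEigenspace G ≤ S ↔
      ∀ t : ℝ, t < 0 → ∀ u, G u = (t : ℂ) • u → u ∈ S := by
  simp only [negEigenspace, iSup_le_iff]
  exact forall₂_congr fun t _ => forall_congr' fun u => by
    rw [Module.End.mem_eigenspace_iff]; rfl

theorem mem_negEigenspace {G : H →L[ℂ] H} {t : ℝ} (ht : t < 0) {u : H}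
    (hu : G u = (t : ℂ) • u) : u ∈ negEigenspace G :=
  negEigenspace_le_iff.1 le_rfl t ht u hu

theorem map_mem_negEigenspace {G : H →L[ℂ] H} {u : H} (hu : u ∈ negEigenspace G) :
    G u ∈ negEigenspace G := by
  have : negEigenspace G ≤ (negEigenspace G).comap (G : H →ₗ[ℂ] H) := by
    rw [negEigenspace_le_iff]
    intro t ht u hu
    rw [Submodule.mem_comap]
    change G u ∈ _
    rw [hu]
    exact Submodule.smul_mem _ _ (mem_negEigenspace ht hu)
  exact this hu

/-- Eigenspaces of a symmetric operator are orthogonal, so the form is a sum of terms `t ‖u_t‖²`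
with every `t < 0`. -/
theorem inner_map_self_neg_of_mem_negEigenspace {G : H →L[ℂ] H}
    (hG : (G : H →ₗ[ℂ] H).IsSymmetric) {u : H} (hu : u ∈ negEigenspace G) (hu0 : u ≠ 0) :
    (inner ℂ u (G u)).re < 0 := by
  classical
  have horth := hG.orthogonalFamily_eigenspaces.comp
    (γ := {t : ℝ // t < 0}) (f := fun t => ((t : ℝ) : ℂ))
    (Complex.ofReal_injective.comp Subtype.val_injective)
  rw [negEigenspace, iSup_subtype', Submodule.mem_iSup_iff_exists_dfinsupp'] at hu
  obtain ⟨f, rfl⟩ := hu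
  have hsum : (f.sum fun _ x => (x : H)) = ∑ i ∈ f.support, (f i : H) := rfl
  rw [hsum] at hu0 ⊢
  have hmap : G (∑ i ∈ f.support, (f i : H)) =
      ∑ i ∈ f.support, ((((i : ℝ) : ℂ) • f i : _) : H) := by
    rw [map_sum]
    refine Finset.sum_congr rfl fun i _ => ?_
    exact Module.End.mem_eigenspace_iff.1 (f i).2
  have key := horth.inner_sum (fun i => f i) (fun i => (((i : ℝ) : ℂ) • f i)) f.support
  have key' : inner ℂ (∑ i ∈ f.support, (f i : H)) (G (∑ i ∈ f.support, (f i : H))) =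
      ∑ i ∈ f.support, inner ℂ (f i) (((i : ℝ) : ℂ) • f i) := by
    rw [hmap]; exact key
  rw [key', Complex.re_sum]
  have hne : f.support.Nonempty := by
    by_contra h
    rw [Finset.not_nonempty_iff_eq_empty] at h
    exact hu0 (by rw [h, Finset.sum_empty])
  refine Finset.sum_neg (fun i hi => ?_) hne
  rw [inner_smul_right, Complex.re_ofReal_mul]
  have h3 : (inner ℂ (f i) (f i)).re = ‖f i‖ ^ 2 := inner_self_eq_norm_sq (𝕜 := ℂ) (f i)
  rw [h3]
  have : 0 < ‖f i‖ := norm_pos_iff.2 (DFinsupp.mem_support_iff.1 hi)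
  exact mul_neg_of_neg_of_pos i.2 (by positivity)

/-- A subspace which meets `Eᗮ` trivially embeds into the finite-dimensional space `E`. -/
theorem finrank_le_of_disjoint_orthogonal {E W : Submodule ℂ H} [FiniteDimensional ℂ E]
    (h : ∀ u ∈ W, u ∈ Eᗮ → u = 0) :
    FiniteDimensional ℂ W ∧ Module.finrank ℂ W ≤ Module.finrank ℂ E := by
  let f : W →ₗ[ℂ] E := (E.orthogonalProjectionOnto : H →ₗ[ℂ] E) ∘ₗ W.subtype
  have hf : Function.Injective f := by
    rw [← LinearMap.ker_eq_bot, LinearMap.ker_eq_bot']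
    intro u hu
    have : E.orthogonalProjectionOnto (u : H) = 0 := hu
    rw [Submodule.orthogonalProjectionOnto_eq_zero_iff] at this
    exact Subtype.ext (h u u.2 this)
  exact ⟨FiniteDimensional.of_injective f hf, LinearMap.finrank_le_finrank_of_injective hf⟩

theorem finrank_negEigenspace_le {G : H →L[ℂ] H} (hG : (G : H →ₗ[ℂ] H).IsSymmetric)
    {E : Submodule ℂ H} [FiniteDimensional ℂ E]
    (hE : ∀ u ∈ Eᗮ, 0 ≤ (inner ℂ u (G u)).re) :
    FiniteDimensional ℂ (negEigenspace G) ∧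
      Module.finrank ℂ (negEigenspace G) ≤ Module.finrank ℂ E := by
  refine finrank_le_of_disjoint_orthogonal fun u hu hu' => ?_
  by_contra h0
  exact absurd (inner_map_self_neg_of_mem_negEigenspace hG hu h0) (not_lt.2 (hE u hu'))

theorem map_mem_negEigenspace_orthogonal {G : H →L[ℂ] H}
    (hG : (G : H →ₗ[ℂ] H).IsSymmetric) {u : H} (hu : u ∈ (negEigenspace G)ᗮ) :
    G u ∈ (negEigenspace G)ᗮ := by
  rw [Submodule.mem_orthogonal] at hu ⊢
  intro v hv
  have := hG v u
  exact (this.symm.trans (hu _ (map_mem_negEigenspace hv)) :)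

/-- Compress `G` to the complement of its negative eigenvectors. A negative spectral point of the
compression would be an eigenvalue, and its eigenvector would be a negative eigenvector of `G`
orthogonal to itself. So the compression has nonnegative spectrum and is a positive operator. -/
theorem inner_map_self_nonneg_of_mem_negEigenspace_orthogonal [CompleteSpace H] {G : H →L[ℂ] H}
    (hG : IsSelfAdjoint G) {E : Submodule ℂ H} [FiniteDimensional ℂ E]
    (hE : ∀ u ∈ Eᗮ, 0 ≤ (inner ℂ u (G u)).re) {u : H} (hu : u ∈ (negEigenspace G)ᗮ) :
    0 ≤ (inner ℂ u (G u)).re := by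
  have hsym := hG.isSymmetric
  have := (finrank_negEigenspace_le hsym hE).1
  set V := negEigenspace G
  set Q := Vᗮ.starProjection
  set G' : H →L[ℂ] H := Q ∘L G ∘L Q
  have hG' : IsSelfAdjoint G' := hG.conj_starProjection Vᗮ
  have hQ : ∀ x ∈ Vᗮ, Q x = x := fun x hx => Submodule.starProjection_eq_self_iff.2 hx
  have hG'V : ∀ x ∈ Vᗮ, G' x = G x := fun x hx => by
    simp only [G', ContinuousLinearMap.comp_apply]
    rw [hQ x hx, hQ _ (map_mem_negEigenspace_orthogonal hsym hx)]
  -- `G'` is known to agree with `G` only on `Vᗮ`, so `E` is enlarged by the finite-dimensional `V`.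
  have hE' : ∀ x ∈ (E ⊔ V)ᗮ, 0 ≤ (inner ℂ x (G' x)).re := fun x hx => by
    rw [hG'V x (Submodule.orthogonal_le le_sup_right hx)]
    exact hE x (Submodule.orthogonal_le le_sup_left hx)
  have hnon : ∀ t : ℝ, t ∈ spectrum ℝ G' → 0 ≤ t := fun t ht => by
    by_contra! hneg
    have ht' : (t : ℂ) ∈ spectrum ℂ G' := (spectrum.algebraMap_mem_iff ℂ).2 ht
    obtain ⟨v, hv, hv0⟩ :=
      (hasEigenvalue_of_mem_spectrum_of_neg hE' hneg ht').exists_hasEigenvector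
    rw [Module.End.mem_eigenspace_iff] at hv
    have hv' : G' v = (t : ℂ) • v := hv
    have htne : (t : ℂ) ≠ 0 := by exact_mod_cast hneg.ne
    have hvV : v ∈ Vᗮ := by
      have h1 : G' v ∈ Vᗮ := Vᗮ.starProjection_apply_mem _
      rw [hv'] at h1
      exact (Submodule.smul_mem_iff _ htne).1 h1
    rw [hG'V v hvV] at hv'
    have h2 : v ∈ V := mem_negEigenspace hneg hv'
    exact hv0 (inner_self_eq_zero.1 (hvV v h2))
  have hpos : 0 ≤ G' := nonneg_iff_isSelfAdjoint_and_quasispectrumRestricts.2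
    ⟨hG', quasispectrumRestricts_iff_spectrumRestricts.2 <| SpectrumRestricts.nnreal_iff.2 hnon⟩
  rw [ContinuousLinearMap.nonneg_iff_isPositive] at hpos
  have := hpos.inner_nonneg_right u
  rw [hG'V u hu] at this
  exact (Complex.le_def.1 this).1

/-- Glazman's lemma: if `G` is nonnegative on a subspace whose sum with the finite-dimensional
space `F` is dense, and strictly negative on a space `W` with `dim F ≤ N ≤ dim W`, then the negative
spectrum of `G` consists of `N` eigenvalues. -/
theorem negative_spectrum_of_dense_sup [CompleteSpace H] {G : H →L[ℂ] H} (hG : IsSelfAdjoint G)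
    {D F W : Submodule ℂ H} [FiniteDimensional ℂ F] (hdense : (D ⊔ F)ᗮ = ⊥)
    (hD : ∀ u ∈ D, 0 ≤ (inner ℂ u (G u)).re)
    (hW : ∀ u ∈ W, u ≠ 0 → (inner ℂ u (G u)).re < 0)
    {N : ℕ} (hF : Module.finrank ℂ F ≤ N)
    (hN : N ≤ Module.finrank ℂ W) :
    (∀ t : ℝ, t < 0 → (t : ℂ) ∈ spectrum ℂ G →
      Module.End.HasEigenvalue (G : H →ₗ[ℂ] H) (t : ℂ)) ∧
    Module.rank ℂ (negEigenspace G) = (N : Cardinal) := by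
  have hsym := hG.isSymmetric
  -- `Dᗮ` meets `Fᗮ` only in `0`, so it embeds into `F`; it serves as the exceptional space, and its
  -- complement is the closure of `D`.
  obtain ⟨hEfin, hEF⟩ := finrank_le_of_disjoint_orthogonal (E := F) (W := Dᗮ) fun u hu hu' => by
    have : u ∈ (D ⊔ F)ᗮ := by
      rw [← Submodule.inf_orthogonal]; exact ⟨hu, hu'⟩
    rwa [hdense, Submodule.mem_bot] at this
  have hE : ∀ u ∈ Dᗮᗮ, 0 ≤ (inner ℂ u (G u)).re := by
    intro u hu
    rw [Submodule.orthogonal_orthogonal_eq_closure] at hu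
    have hcl : IsClosed {u : H | 0 ≤ (inner ℂ u (G u)).re} :=
      isClosed_le continuous_const (Complex.continuous_re.comp (by fun_prop))
    exact closure_minimal (fun v hv => hD v hv) hcl hu
  refine ⟨fun t ht hs => hasEigenvalue_of_mem_spectrum_of_neg hE ht hs, ?_⟩
  obtain ⟨hfin, hle⟩ := finrank_negEigenspace_le hsym hE
  have hge := (finrank_le_of_disjoint_orthogonal (E := negEigenspace G) (W := W)
    fun u hu hu' => by
      by_contra h0
      exact absurd (hW u hu h0)
        (not_lt.2 (inner_map_self_nonneg_of_mem_negEigenspace_orthogonal hG hE hu'))).2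
  rw [← Module.finrank_eq_rank]
  congr 1
  omega

/-- A nondegenerate Hermitian form which is nonpositive on `U` is strictly negative on a subspace
whose dimension is at least that of `U`. -/
theorem finrank_le_finrank_negEigenspace_of_nonpos [FiniteDimensional ℂ H] {T : H →L[ℂ] H}
    (hT : (T : H →ₗ[ℂ] H).IsSymmetric) (hinj : ∀ u, T u = 0 → u = 0) {U : Submodule ℂ H}
    (hU : ∀ u ∈ U, (inner ℂ u (T u)).re ≤ 0) :
    Module.finrank ℂ U ≤ Module.finrank ℂ (negEigenspace T) := by
  have : CompleteSpace H := FiniteDimensional.complete ℂ H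
  have hsa : IsSelfAdjoint T := ContinuousLinearMap.isSelfAdjoint_iff_isSymmetric.2 hT
  have hpos : ∀ u ∈ (negEigenspace T)ᗮ, 0 ≤ (inner ℂ u (T u)).re := fun u hu =>
    inner_map_self_nonneg_of_mem_negEigenspace_orthogonal hsa (E := ⊤)
      (fun u hu => by
        rw [Submodule.top_orthogonal_eq_bot, Submodule.mem_bot] at hu; simp [hu]) hu
  refine (finrank_le_of_disjoint_orthogonal fun u hu hu' => hinj u ?_).2
  have h0 : (inner ℂ u (T u)).re = 0 := le_antisymm (hU u hu) (hpos u hu')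
  have hTu := map_mem_negEigenspace_orthogonal hT hu'
  -- A null vector of a nonnegative form lies in its kernel: test the form on `u + s T u`. If `T u ≠
  -- 0`, a small negative `s` gives a contradiction.
  have key : ∀ s : ℝ, 0 ≤ 2 * s * ‖T u‖ ^ 2 + s ^ 2 * (inner ℂ (T u) (T (T u))).re := by
    intro s
    have h1 := hpos (u + (s : ℂ) • T u) (Submodule.add_mem _ hu' (Submodule.smul_mem _ _ hTu))
    have h2 : inner ℂ u (T (T u)) = inner ℂ (T u) (T u) := (hT u (T u)).symm
    have h3 : (inner ℂ (T u) (T u)).re = ‖T u‖ ^ 2 := inner_self_eq_norm_sq (𝕜 := ℂ) (T u)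
    simp only [map_add, map_smul, inner_add_left, inner_add_right, inner_smul_left,
      inner_smul_right, Complex.conj_ofReal, h2, Complex.add_re, Complex.re_ofReal_mul, h0,
      h3] at h1
    nlinarith
  by_contra hne
  have hp : 0 < ‖T u‖ ^ 2 := by positivity
  set a := ‖T u‖ ^ 2
  set c := (inner ℂ (T u) (T (T u))).re
  have hc : 0 < |c| + 1 := by positivity
  have h4 := key (-(a / (|c| + 1)))
  have h5 : (a / (|c| + 1)) * (|c| + 1) = a := by field_simp
  set s := a / (|c| + 1)
  have hs : 0 < s := by positivity
  have h6 : s * c ≤ s * |c| := mul_le_mul_of_nonneg_left (le_abs_self c) hs.le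
  nlinarith

end NegativeSpectrum

open Polynomial in
/-- The polynomial with conjugate coefficients. -/
noncomputable def conjPoly (p : ℂ[X]) : ℂ[X] := p.map (starRingEnd ℂ)

/-! ### Polynomials with conjugated coefficients -/

section ConjPoly

open Polynomial

@[simp] theorem conjPoly_mul (p q : ℂ[X]) : conjPoly (p * q) = conjPoly p * conjPoly q :=
  Polynomial.map_mul _

@[simp] theorem conjPoly_add (p q : ℂ[X]) : conjPoly (p + q) = conjPoly p + conjPoly q :=
  Polynomial.map_add _

@[simp] theorem conjPoly_pow (p : ℂ[X]) (n : ℕ) : conjPoly (p ^ n) = conjPoly p ^ n :=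
  Polynomial.map_pow _ _

@[simp] theorem conjPoly_X_sub_C (b : ℂ) :
    conjPoly (X - C b) = X - C ((starRingEnd ℂ) b) := by
  simp [conjPoly]

@[simp] theorem conjPoly_conjPoly (p : ℂ[X]) : conjPoly (conjPoly p) = p := by
  ext; simp [conjPoly]

theorem eval_conjPoly (p : ℂ[X]) (z : ℂ) :
    (conjPoly p).eval z = (starRingEnd ℂ) (p.eval ((starRingEnd ℂ) z)) := by
  rw [conjPoly, ← Polynomial.eval₂_at_apply, Polynomial.eval_map, Complex.conj_conj]

theorem conjPoly_dvd {p q : ℂ[X]} (h : p ∣ q) : conjPoly p ∣ conjPoly q :=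
  Polynomial.map_dvd _ h

theorem eval_mul_conjPoly_of_real (p : ℂ[X]) {z : ℂ} (hz : z.im = 0) :
    (p * conjPoly p).eval z = ((‖p.eval z‖ ^ 2 : ℝ) : ℂ) := by
  rw [eval_mul, eval_conjPoly, Complex.conj_eq_iff_im.2 hz, Complex.mul_conj, Complex.normSq_eq_norm_sq]

end ConjPoly

/-- A zero of order `negCount K p` becomes one of order `2 * negCount K p` in `u u*`. This exceeds
`K` except when `K` is even and `p > 0`, where it equals `K`. -/
theorem two_mul_negCount (K : ℕ) (p : ℝ) :
    2 * negCount K p = if Odd K then K + 1 else if 0 < p then K else K + 2 := by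
  unfold negCount
  split_ifs with h1 h2
  · obtain ⟨m, rfl⟩ := h1; omega
  · obtain ⟨m, rfl⟩ := Nat.not_odd_iff_even.1 h1; omega
  · obtain ⟨m, rfl⟩ := Nat.not_odd_iff_even.1 h1; omega

/-- The form on jets of order `K`, of dimension `K + 1`, is nondegenerate: its negative and positive
squares exhaust it. -/
theorem negCount_add_negCount_neg (K : ℕ) {p : ℝ} (hp : p ≠ 0) :
    negCount K p + negCount K (-p) = K + 1 := by
  have h1 := two_mul_negCount K p
  have h2 := two_mul_negCount K (-p)
  rcases lt_or_gt_of_ne hp with h | h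
  · simp only [h.not_gt, Left.neg_pos_iff, h, if_true, if_false] at h1 h2
    split_ifs at h1 h2 <;> omega
  · simp only [h, Left.neg_pos_iff, h.not_gt, if_true, if_false] at h1 h2
    split_ifs at h1 h2 <;> omega

/-! ### Real functionals supported on jets at finitely many nodes -/

section Nodes

open Polynomial

variable {ι : Type*} [Fintype ι]

/-- The monic polynomial with the root `β i` of multiplicity `e i`. -/
noncomputable def nodePoly (β : ι → ℂ) (e : ι → ℕ) : ℂ[X] := ∏ i, (X - C (β i)) ^ e i

theorem monic_nodePoly (β : ι → ℂ) (e : ι → ℕ) : (nodePoly β e).Monic :=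
  monic_prod_of_monic _ _ fun _ _ => (monic_X_sub_C _).pow _

theorem natDegree_nodePoly (β : ι → ℂ) (e : ι → ℕ) : (nodePoly β e).natDegree = ∑ i, e i := by
  rw [nodePoly, natDegree_prod_of_monic _ _ fun i _ => (monic_X_sub_C _).pow _]
  simp

theorem pow_dvd_nodePoly (β : ι → ℂ) (e : ι → ℕ) (i : ι) :
    (X - C (β i)) ^ e i ∣ nodePoly β e :=
  Finset.dvd_prod_of_mem (fun i => (X - C (β i)) ^ e i) (Finset.mem_univ i)

/-- The number of negative squares contributed by the node `β i`, a pair of conjugate nodes being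
counted at the one in the upper half-plane. -/
noncomputable def negMultiplicity {ι : Type*} (β : ι → ℂ) (K : ι → ℕ) (c : ι → ℂ) (i : ι) : ℕ :=
  if (β i).im = 0 then negCount (K i) (c i).re else if 0 < (β i).im then K i + 1 else 0

/-- `L = ∑ i, L i` is a linear functional on polynomials which is real on real polynomials, and
`L i` depends on the jet of order `K i` at the node `β i`, with leading coefficient `c i ≠ 0`. -/
structure IsNodalFunctional (β : ι → ℂ) (K : ι → ℕ) (c : ι → ℂ) (L : ι → ℂ[X] →ₗ[ℂ] ℂ) :
    Prop where
  injective : Function.Injective β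
  coeff_ne_zero : ∀ i, c i ≠ 0
  apply_pow_mul : ∀ i f, L i ((X - C (β i)) ^ K i * f) = c i * f.eval (β i)
  sum_conjPoly : ∀ f, ∑ i, L i (conjPoly f) = (starRingEnd ℂ) (∑ i, L i f)

namespace IsNodalFunctional

variable {β : ι → ℂ} {K : ι → ℕ} {c : ι → ℂ} {L : ι → ℂ[X] →ₗ[ℂ] ℂ}

theorem neg (h : IsNodalFunctional β K c L) :
    IsNodalFunctional β K (fun i => -c i) (fun i => -L i) where
  injective := h.injective
  coeff_ne_zero i := neg_ne_zero.2 (h.coeff_ne_zero i)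
  apply_pow_mul i f := by simp [h.apply_pow_mul]
  sum_conjPoly f := by simp [h.sum_conjPoly]

theorem apply_eq_zero_of_dvd (h : IsNodalFunctional β K c L) {i : ι} {f : ℂ[X]}
    (hf : (X - C (β i)) ^ (K i + 1) ∣ f) : L i f = 0 := by
  obtain ⟨g, rfl⟩ := hf
  rw [pow_succ, mul_assoc, h.apply_pow_mul]
  simp

theorem sum_apply_eq_zero_of_dvd (h : IsNodalFunctional β K c L) {f : ℂ[X]}
    (hf : nodePoly β (fun i => K i + 1) ∣ f) : ∑ i, L i f = 0 :=
  Finset.sum_eq_zero fun i _ => h.apply_eq_zero_of_dvd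
    ((pow_dvd_nodePoly β (fun i => K i + 1) i).trans hf)

theorem sum_apply_eq_single (h : IsNodalFunctional β K c L) (i : ι) {f : ℂ[X]}
    (hf : ∀ j, j ≠ i → (X - C (β j)) ^ (K j + 1) ∣ f) : ∑ j, L j f = L i f :=
  Finset.sum_eq_single_of_mem i (Finset.mem_univ i) fun j _ hj =>
    h.apply_eq_zero_of_dvd (hf j hj)

theorem isCoprime (h : IsNodalFunctional β K c L) {i j : ι} (hij : i ≠ j) (m n : ℕ) :
    IsCoprime ((X - C (β i)) ^ m) ((X - C (β j)) ^ n) :=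
  (pairwise_coprime_X_sub_C h.injective hij).pow

/-- If `u` vanishes at `β i` to order `e ≤ K i`, multiply it by `(X - β i)^(K i - e)` and by the
full factors of the other nodes. Only the leading term at `β i` survives, and it is nonzero. So the
radical of `(u, v) ↦ Λ(u v)` lies in the ideal of the node polynomial. -/
theorem nodePoly_dvd_of_forall (h : IsNodalFunctional β K c L) {u : ℂ[X]}
    (hu : ∀ v, ∑ i, L i (u * v) = 0) : nodePoly β (fun i => K i + 1) ∣ u := by
  classical
  refine Finset.prod_dvd_of_coprime (fun i _ j _ hij => h.isCoprime hij _ _) fun i _ => ?_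
  rcases eq_or_ne u 0 with rfl | hu0
  · exact dvd_zero _
  obtain ⟨w, hw, hnd⟩ := exists_eq_pow_rootMultiplicity_mul_and_not_dvd u hu0 (β i)
  set e := rootMultiplicity (β i) u
  rcases Nat.lt_or_ge (K i) e with hlt | hge
  · exact (pow_dvd_pow _ hlt).trans ⟨w, hw⟩
  exfalso
  set r : ℂ[X] := ∏ j ∈ Finset.univ.erase i, (X - C (β j)) ^ (K j + 1)
  have h1 := hu ((X - C (β i)) ^ (K i - e) * r)
  have h2 : u * ((X - C (β i)) ^ (K i - e) * r) = (X - C (β i)) ^ K i * (w * r) := by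
    conv_lhs => rw [hw]
    rw [show (X - C (β i)) ^ K i = (X - C (β i)) ^ e * (X - C (β i)) ^ (K i - e) by
      rw [← pow_add, Nat.add_sub_cancel' hge]]
    ring
  rw [h2, h.sum_apply_eq_single i, h.apply_pow_mul, eval_mul] at h1
  · rcases mul_eq_zero.1 h1 with h1 | h1
    · exact h.coeff_ne_zero i h1
    rcases mul_eq_zero.1 h1 with h1 | h1
    · exact hnd (dvd_iff_isRoot.2 h1)
    · rw [eval_prod, Finset.prod_eq_zero_iff] at h1
      obtain ⟨j, hj, h1⟩ := h1
      rw [eval_pow, eval_sub, eval_X, eval_C] at h1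
      exact (Finset.mem_erase.1 hj).1 (h.injective (sub_eq_zero.1 (pow_eq_zero_iff (Nat.succ_ne_zero _) |>.1 h1)).symm)
  · intro j hj
    exact ((Finset.dvd_prod_of_mem (fun j => (X - C (β j)) ^ (K j + 1))
      (Finset.mem_erase.2 ⟨hj, Finset.mem_univ j⟩)).mul_left _).mul_left _

/-- Reality of the functional makes its radical invariant under conjugation. -/
theorem nodePoly_dvd_conjPoly (h : IsNodalFunctional β K c L) :
    nodePoly β (fun i => K i + 1) ∣ conjPoly (nodePoly β fun i => K i + 1) := by
  refine h.nodePoly_dvd_of_forall fun v => ?_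
  have : conjPoly (nodePoly β fun i => K i + 1) * v =
      conjPoly ((nodePoly β fun i => K i + 1) * conjPoly v) := by simp
  rw [this, h.sum_conjPoly, h.sum_apply_eq_zero_of_dvd (dvd_mul_right _ _), map_zero]

/-- The factor at `conj (β i)` divides the node polynomial. Coprimality of distinct nodes forces all
of it into a single factor, which bounds the orders. -/
theorem exists_conj (h : IsNodalFunctional β K c L) (i : ι) :
    ∃ j, β j = (starRingEnd ℂ) (β i) ∧ K i ≤ K j := by
  classical
  set q := nodePoly β fun i => K i + 1 with hq
  have h1 : conjPoly q ∣ q := by simpa using conjPoly_dvd h.nodePoly_dvd_conjPoly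
  have h2 : (X - C ((starRingEnd ℂ) (β i))) ^ (K i + 1) ∣ q := by
    have := conjPoly_dvd (pow_dvd_nodePoly β (fun i => K i + 1) i)
    simp only [conjPoly_pow, conjPoly_X_sub_C] at this
    exact this.trans h1
  have h3 : q.eval ((starRingEnd ℂ) (β i)) = 0 :=
    dvd_iff_isRoot.1 ((dvd_pow_self _ (Nat.succ_ne_zero _)).trans h2)
  rw [hq, nodePoly, eval_prod, Finset.prod_eq_zero_iff] at h3
  obtain ⟨j, -, hj⟩ := h3
  rw [eval_pow, eval_sub, eval_X, eval_C] at hj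
  have hj' := (sub_eq_zero.1 (pow_eq_zero_iff (Nat.succ_ne_zero _) |>.1 hj)).symm
  refine ⟨j, hj', ?_⟩
  rw [← hj', hq, nodePoly, ← Finset.mul_prod_erase _ _ (Finset.mem_univ j)] at h2
  have h4 : IsCoprime ((X - C (β j)) ^ (K i + 1))
      (∏ l ∈ Finset.univ.erase j, (X - C (β l)) ^ (K l + 1)) :=
    IsCoprime.prod_right fun l hl => h.isCoprime (Finset.mem_erase.1 hl).1.symm _ _
  have h5 := h4.dvd_of_dvd_mul_right h2
  have h6 := natDegree_le_of_dvd h5 ((monic_X_sub_C _).pow _).ne_zero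
  simpa using h6

/-- Test on the real polynomial `(X - β i)^(K i) r r*`, with `r` killing the other nodes: the value
`c i |r(β i)|²` must be real. -/
theorem coeff_im_eq_zero (h : IsNodalFunctional β K c L) {i : ι} (hi : (β i).im = 0) :
    (c i).im = 0 := by
  classical
  set r : ℂ[X] := ∏ j ∈ Finset.univ.erase i, (X - C (β j)) ^ (K j + 1) with hr
  have hb : (starRingEnd ℂ) (β i) = β i := Complex.conj_eq_iff_im.2 hi
  set f : ℂ[X] := (X - C (β i)) ^ K i * (r * conjPoly r)
  have hf : conjPoly f = f := by simp [f, hb, mul_comm]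
  have h1 : ∑ j, L j f = c i * ((‖r.eval (β i)‖ ^ 2 : ℝ) : ℂ) := by
    rw [h.sum_apply_eq_single i, h.apply_pow_mul, eval_mul_conjPoly_of_real _ hi]
    intro j hj
    exact ((Finset.dvd_prod_of_mem (fun j => (X - C (β j)) ^ (K j + 1))
      (Finset.mem_erase.2 ⟨hj, Finset.mem_univ j⟩)).mul_right _).mul_left _
  have h2 := h.sum_conjPoly f
  rw [hf, eq_comm, Complex.conj_eq_iff_im, h1, Complex.im_mul_ofReal] at h2
  refine (mul_eq_zero.1 h2).resolve_right ?_
  have : r.eval (β i) ≠ 0 := by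
    rw [hr, eval_prod, Finset.prod_ne_zero_iff]
    intro j hj
    rw [eval_pow, eval_sub, eval_X, eval_C]
    exact pow_ne_zero _ (sub_ne_zero.2 fun hh => (Finset.mem_erase.1 hj).1 (h.injective hh.symm))
  positivity

theorem coeff_re_ne_zero (h : IsNodalFunctional β K c L) {i : ι} (hi : (β i).im = 0) :
    (c i).re ≠ 0 := fun h0 =>
  h.coeff_ne_zero i (Complex.ext h0 (h.coeff_im_eq_zero hi))

/-- Either `u u*` vanishes beyond the order of the jet, or exactly the leading term remains and
equals `c i |w(β i)|²` with `c i` of positive real part. -/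
theorem re_apply_mul_conjPoly_nonneg_of_real (h : IsNodalFunctional β K c L) {i : ι}
    (hi : (β i).im = 0) {u : ℂ[X]} (hu : (X - C (β i)) ^ negCount (K i) (c i).re ∣ u) :
    0 ≤ (L i (u * conjPoly u)).re := by
  have hb : (starRingEnd ℂ) (β i) = β i := Complex.conj_eq_iff_im.2 hi
  obtain ⟨w, rfl⟩ := hu
  set m := negCount (K i) (c i).re
  have h1 : (X - C (β i)) ^ m * w * conjPoly ((X - C (β i)) ^ m * w) =
      (X - C (β i)) ^ (2 * m) * (w * conjPoly w) := by
    simp only [conjPoly_mul, conjPoly_pow, conjPoly_X_sub_C, hb]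
    ring
  have hm := two_mul_negCount (K i) (c i).re
  rw [h1]
  split_ifs at hm with ho hp
  · rw [h.apply_eq_zero_of_dvd ((pow_dvd_pow _ hm.ge).mul_right _), Complex.zero_re]
  · rw [show 2 * m = K i from hm, h.apply_pow_mul, eval_mul_conjPoly_of_real _ hi,
      Complex.re_mul_ofReal]
    positivity
  · rw [h.apply_eq_zero_of_dvd ((pow_dvd_pow _ (by omega)).mul_right _), Complex.zero_re]

/-- At a nonreal pair it is enough that `u` vanishes fully at one of the two nodes, since `u*` then
vanishes at the other. The exponents are left free so that the lemma applies to both `L` and `-L`.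
-/
theorem re_sum_apply_mul_conjPoly_nonneg (h : IsNodalFunctional β K c L) {e : ι → ℕ}
    (he : ∀ i, (β i).im = 0 → e i = negCount (K i) (c i).re)
    (he' : ∀ i, (β i).im ≠ 0 →
      K i + 1 ≤ e i ∨ ∃ j, β j = (starRingEnd ℂ) (β i) ∧ K i + 1 ≤ e j)
    {u : ℂ[X]} (hu : nodePoly β e ∣ u) : 0 ≤ (∑ i, L i (u * conjPoly u)).re := by
  rw [Complex.re_sum]
  refine Finset.sum_nonneg fun i _ => ?_
  have hdvd : ∀ j, (X - C (β j)) ^ e j ∣ u := fun j => (pow_dvd_nodePoly β e j).trans hu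
  by_cases hi : (β i).im = 0
  · exact h.re_apply_mul_conjPoly_nonneg_of_real hi (he i hi ▸ hdvd i)
  · refine (congrArg Complex.re (h.apply_eq_zero_of_dvd ?_)).ge
    rcases he' i hi with h1 | ⟨j, hj, h1⟩
    · exact ((pow_dvd_pow _ h1).trans (hdvd i)).mul_right _
    · have := conjPoly_dvd ((pow_dvd_pow _ h1).trans (hdvd j))
      simp only [conjPoly_pow, conjPoly_X_sub_C, hj, Complex.conj_conj] at this
      exact this.mul_left _

theorem negMultiplicity_le (h : IsNodalFunctional β K c L) (i : ι) :
    negMultiplicity β K c i ≤ K i + 1 := by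
  unfold negMultiplicity
  split_ifs with h1 h2
  · have := negCount_add_negCount_neg (K i) (h.coeff_re_ne_zero h1)
    omega
  · rfl
  · exact Nat.zero_le _

theorem re_nonneg_of_negMultiplicity (h : IsNodalFunctional β K c L) {u : ℂ[X]}
    (hu : nodePoly β (negMultiplicity β K c) ∣ u) : 0 ≤ (∑ i, L i (u * conjPoly u)).re := by
  refine h.re_sum_apply_mul_conjPoly_nonneg (fun i hi => if_pos hi) (fun i hi => ?_) hu
  change K i + 1 ≤ negMultiplicity β K c i ∨
    ∃ j, β j = (starRingEnd ℂ) (β i) ∧ K i + 1 ≤ negMultiplicity β K c j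
  by_cases hp : 0 < (β i).im
  · left; rw [negMultiplicity, if_neg hi, if_pos hp]
  · right
    obtain ⟨j, hj, hK⟩ := h.exists_conj i
    have hjim : (β j).im = -(β i).im := by rw [hj, Complex.conj_im]
    have : (β i).im < 0 := lt_of_le_of_ne (not_lt.1 hp) hi
    refine ⟨j, hj, ?_⟩
    rw [negMultiplicity, if_neg (by rw [hjim]; exact neg_ne_zero.2 hi), if_pos (by linarith)]
    omega

/-- Apply the nonnegativity criterion to `-L`. The complementary exponent is `negCount` of the
opposite sign at real nodes, and the full order at nodes in the lower half-plane. -/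
theorem re_nonpos_of_sub_negMultiplicity (h : IsNodalFunctional β K c L) {u : ℂ[X]}
    (hu : nodePoly β (fun i => K i + 1 - negMultiplicity β K c i) ∣ u) :
    (∑ i, L i (u * conjPoly u)).re ≤ 0 := by
  have := h.neg.re_sum_apply_mul_conjPoly_nonneg (fun i hi => ?_) (fun i hi => ?_) hu
  · simpa using this
  · have := negCount_add_negCount_neg (K i) (h.coeff_re_ne_zero hi)
    rw [negMultiplicity, if_pos hi, Complex.neg_re]
    omega
  · by_cases hp : 0 < (β i).im
    · right
      obtain ⟨j, hj, hK⟩ := h.exists_conj i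
      have hjim : (β j).im = -(β i).im := by rw [hj, Complex.conj_im]
      refine ⟨j, hj, ?_⟩
      rw [negMultiplicity, if_neg (by rw [hjim]; exact neg_ne_zero.2 hi), if_neg (by linarith)]
      omega
    · left; rw [negMultiplicity, if_neg hi, if_neg hp]; omega

end IsNodalFunctional

end Nodes

/-! ### Density of polynomial ideals in `L²(-1, 1)` -/

section Approximation

open Polynomial

theorem exists_poly_norm_sub_lt (g : ℝ → ℂ) (hg : Continuous g) {ε : ℝ} (hε : 0 < ε) :
    ∃ h : ℂ[X], ∀ t ∈ Set.Icc (-1 : ℝ) 1, ‖h.eval (t : ℂ) - g t‖ < ε := by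
  obtain ⟨p, hp⟩ := exists_polynomial_near_of_continuousOn (-1) 1 (fun t => (g t).re)
    (Complex.continuous_re.comp hg).continuousOn (ε / 2) (by positivity)
  obtain ⟨r, hr⟩ := exists_polynomial_near_of_continuousOn (-1) 1 (fun t => (g t).im)
    (Complex.continuous_im.comp hg).continuousOn (ε / 2) (by positivity)
  have hev : ∀ (p : ℝ[X]) (t : ℝ), (p.map Complex.ofRealHom).eval (t : ℂ) = (p.eval t : ℝ) :=
    fun p t => by
      rw [Polynomial.eval_map]; exact Polynomial.eval₂_at_apply Complex.ofRealHom t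
  refine ⟨p.map Complex.ofRealHom + C Complex.I * r.map Complex.ofRealHom, fun t ht => ?_⟩
  rw [eval_add, eval_mul, eval_C, hev, hev]
  refine (Complex.norm_le_abs_re_add_abs_im _).trans_lt ?_
  have h1 := hp t ht
  have h2 := hr t ht
  simp only [Complex.sub_re, Complex.add_re, Complex.ofReal_re, Complex.re_mul_ofReal,
    Complex.I_re, Complex.sub_im, Complex.add_im, Complex.ofReal_im, Complex.im_mul_ofReal,
    Complex.I_im, zero_mul, one_mul, add_zero, zero_add]
  linarith

theorem continuous_eval_ofReal (u : ℂ[X]) : Continuous fun t : ℝ => u.eval (t : ℂ) :=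
  u.continuous.comp Complex.continuous_ofReal

/-- The ideal generated by a nonzero polynomial is dense in `L²(-1, 1)`. -/
theorem exists_integral_norm_sub_mul_sq_lt (u : ℂ[X]) {q : ℂ[X]} (hq : q ≠ 0) {ε : ℝ}
    (hε : 0 < ε) :
    ∃ h : ℂ[X], ∫ t in (-1 : ℝ)..1, ‖(u - q * h).eval (t : ℂ)‖ ^ 2 < ε := by
  set U : ℝ → ℂ := fun t => u.eval (t : ℂ)
  set Q : ℝ → ℂ := fun t => q.eval (t : ℂ)
  have hU : Continuous U := continuous_eval_ofReal u
  have hQ : Continuous Q := continuous_eval_ofReal q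
  -- Regularized division: with `g = n U conj(Q) / (n |Q|² + 1)` the error `U - Q g` equals `U / (n
  -- |Q|² + 1)`. It tends to `0` off the finitely many zeros of `Q`.
  have hlim : Filter.Tendsto
      (fun n : ℕ => ∫ t in (-1 : ℝ)..1, (‖U t‖ * (1 / ((n : ℝ) * ‖Q t‖ ^ 2 + 1))) ^ 2)
      Filter.atTop (nhds (∫ _ in (-1 : ℝ)..1, (0 : ℝ))) := by
    refine intervalIntegral.tendsto_integral_filter_of_dominated_convergence
      (fun t => ‖U t‖ ^ 2) ?_ ?_ ?_ ?_
    · refine Filter.Eventually.of_forall fun n => Continuous.aestronglyMeasurable ?_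
      have : ∀ t, (n : ℝ) * ‖Q t‖ ^ 2 + 1 ≠ 0 := fun t => by positivity
      fun_prop (disch := assumption)
    · refine Filter.Eventually.of_forall fun n => Filter.Eventually.of_forall fun t _ => ?_
      rw [Real.norm_of_nonneg (by positivity)]
      refine pow_le_pow_left₀ (by positivity) ?_ 2
      refine mul_le_of_le_one_right (norm_nonneg _) ?_
      rw [div_le_one (by positivity)]
      have : 0 ≤ (n : ℝ) * ‖Q t‖ ^ 2 := by positivity
      linarith
    · exact (by fun_prop : Continuous fun t => ‖U t‖ ^ 2).intervalIntegrable _ _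
    · have hfin : Set.Finite {t : ℝ | Q t = 0} := by
        have h1 : {t : ℝ | Q t = 0} ⊆ (fun t : ℝ => (t : ℂ)) ⁻¹' (q.rootSet ℂ) := by
          intro t ht
          rw [Set.mem_preimage, mem_rootSet]
          exact ⟨hq, by simpa using ht⟩
        exact (Set.Finite.preimage Complex.ofReal_injective.injOn
          (rootSet_finite q ℂ)).subset h1
      have hae : ∀ᵐ t : ℝ, Q t ≠ 0 := by
        rw [ae_iff]
        simpa using hfin.measure_zero volume
      filter_upwards [hae] with t ht _
      have hpos : 0 < ‖Q t‖ ^ 2 := by positivity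
      have h2 : Filter.Tendsto (fun n : ℕ => (n : ℝ) * ‖Q t‖ ^ 2 + 1) Filter.atTop
          Filter.atTop :=
        Filter.tendsto_atTop_add_const_right _ _
          (tendsto_natCast_atTop_atTop.atTop_mul_const hpos)
      have h3 := (h2.const_div_atTop (r := (1 : ℝ)))
      simpa using (h3.const_mul ‖U t‖).pow 2
  rw [intervalIntegral.integral_zero] at hlim
  obtain ⟨n, hn⟩ := (hlim.eventually_lt_const (show (0 : ℝ) < ε / 4 by positivity)).exists
  have hden : ∀ t, (n : ℝ) * ‖Q t‖ ^ 2 + 1 ≠ 0 := fun t => by positivity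
  have hden' : ∀ t, ((n : ℂ) * (‖Q t‖ : ℂ) ^ 2 + 1) ≠ 0 := fun t => by exact_mod_cast hden t
  set g : ℝ → ℂ := fun t => U t * ((n : ℂ) * (starRingEnd ℂ) (Q t)) /
    ((n : ℂ) * (‖Q t‖ : ℂ) ^ 2 + 1) with hgdef
  have hg : Continuous g := by
    refine Continuous.div ?_ (by fun_prop) hden'
    exact hU.mul (continuous_const.mul (Complex.continuous_conj.comp hQ))
  have hres : ∀ t, ‖U t - Q t * g t‖ = ‖U t‖ * (1 / ((n : ℝ) * ‖Q t‖ ^ 2 + 1)) := by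
    intro t
    have h1 : U t - Q t * g t = U t * (1 / ((n : ℂ) * (‖Q t‖ : ℂ) ^ 2 + 1)) := by
      have h2 : Q t * (starRingEnd ℂ) (Q t) = (‖Q t‖ : ℂ) ^ 2 := Complex.mul_conj' (Q t)
      rw [hgdef]
      field_simp [hden' t]
      linear_combination (-(n : ℂ) * U t) * h2
    have h3 : ((n : ℂ) * (‖Q t‖ : ℂ) ^ 2 + 1) = (((n : ℝ) * ‖Q t‖ ^ 2 + 1 : ℝ) : ℂ) := by
      push_cast; rfl
    rw [h1, h3, norm_mul, norm_div, norm_one, Complex.norm_real,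
      Real.norm_of_nonneg (by positivity)]
  obtain ⟨B, hB⟩ := isCompact_Icc.exists_bound_of_continuousOn
    (s := Set.Icc (-1 : ℝ) 1) hQ.continuousOn
  have hB0 : 0 ≤ B := (norm_nonneg _).trans (hB 0 (by norm_num))
  -- Chosen so that `(B δ)² ≤ ε / 64`; on an interval of length `2` the total error is below `2 (ε /
  -- 4) + 4 (ε / 64) < ε`.
  set δ : ℝ := ε / (8 * (B ^ 2 + 1) * (ε + 1)) with hδ
  have hBp : 0 < B ^ 2 + 1 := by positivity
  have hδ0 : 0 < δ := by positivity
  obtain ⟨h, hh⟩ := exists_poly_norm_sub_lt g hg hδ0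
  refine ⟨h, ?_⟩
  have hbd : ∀ t ∈ Set.Icc (-1 : ℝ) 1, ‖(u - q * h).eval (t : ℂ)‖ ^ 2 ≤
      2 * (‖U t‖ * (1 / ((n : ℝ) * ‖Q t‖ ^ 2 + 1))) ^ 2 + 2 * (B * δ) ^ 2 := by
    intro t ht
    have h1 : (u - q * h).eval (t : ℂ) =
        (U t - Q t * g t) - Q t * (h.eval (t : ℂ) - g t) := by
      simp only [eval_sub, eval_mul, U, Q]; ring
    have h2 : ‖(u - q * h).eval (t : ℂ)‖ ≤
        ‖U t‖ * (1 / ((n : ℝ) * ‖Q t‖ ^ 2 + 1)) + B * δ := by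
      rw [h1, ← hres]
      refine (norm_sub_le _ _).trans ?_
      rw [norm_mul]
      gcongr
      · exact hB t ht
      · exact (hh t ht).le
    have h3 : 0 ≤ ‖U t‖ * (1 / ((n : ℝ) * ‖Q t‖ ^ 2 + 1)) := by positivity
    have h4 := norm_nonneg ((u - q * h).eval (t : ℂ))
    have h5 : ‖(u - q * h).eval (t : ℂ)‖ ^ 2 ≤
      (‖U t‖ * (1 / ((n : ℝ) * ‖Q t‖ ^ 2 + 1)) + B * δ) ^ 2 := pow_le_pow_left₀ h4 h2 2
    nlinarith [sq_nonneg (‖U t‖ * (1 / ((n : ℝ) * ‖Q t‖ ^ 2 + 1)) - B * δ)]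
  have hc1 : Continuous fun t : ℝ => ‖(u - q * h).eval (t : ℂ)‖ ^ 2 :=
    (continuous_eval_ofReal _).norm.pow 2
  have hc2 : Continuous fun t : ℝ => (‖U t‖ * (1 / ((n : ℝ) * ‖Q t‖ ^ 2 + 1))) ^ 2 := by
    fun_prop (disch := assumption)
  have hmono := intervalIntegral.integral_mono_on (μ := volume) (a := -1) (b := 1) (by norm_num)
    (hc1.intervalIntegrable _ _)
    (((hc2.const_mul 2).add continuous_const).intervalIntegrable _ _) hbd
  simp only [Pi.add_apply] at hmono
  rw [intervalIntegral.integral_add ((hc2.const_mul 2).intervalIntegrable _ _)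
    (continuous_const.intervalIntegrable _ _), intervalIntegral.integral_const_mul,
    intervalIntegral.integral_const, smul_eq_mul] at hmono
  refine hmono.trans_lt ?_
  have h6 : (B * δ) ^ 2 ≤ ε / 64 := by
    have h7 : (B ^ 2 + 1) * δ = ε / (8 * (ε + 1)) := by rw [hδ]; field_simp
    have h8 : δ ≤ 1 / 8 := by
      rw [hδ, div_le_div_iff₀ (by positivity) (by norm_num)]
      nlinarith [sq_nonneg B, mul_nonneg (sq_nonneg B) hε.le]
    have h9 : ε / (8 * (ε + 1)) ≤ ε / 8 := by
      apply div_le_div_of_nonneg_left hε.le (by norm_num) (by linarith)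
    have h10 : (B * δ) ^ 2 ≤ ((B ^ 2 + 1) * δ) * δ := by nlinarith
    have h11 : ((B ^ 2 + 1) * δ) * δ ≤ (ε / 8) * (1 / 8) := by
      rw [h7]; exact mul_le_mul h9 h8 hδ0.le (by positivity)
    linarith
  linarith

end Approximation

/-! ### Finite Hankel matrices and the negative test space -/

section HankelMatrix

open Polynomial

/-- The linear combinations of a finite family of polynomials. -/
noncomputable def polyComb {n : ℕ} (g : Fin n → ℂ[X]) : EuclideanSpace ℂ (Fin n) →ₗ[ℂ] ℂ[X] :=
  Fintype.linearCombination ℂ g ∘ₗ (WithLp.linearEquiv 2 ℂ (Fin n → ℂ)).toLinearMap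

theorem polyComb_apply {n : ℕ} (g : Fin n → ℂ[X]) (x : EuclideanSpace ℂ (Fin n)) :
    polyComb g x = ∑ k, x k • g k := rfl

theorem coeff_polyComb_X_pow {n : ℕ} (x : EuclideanSpace ℂ (Fin n)) (j : Fin n) :
    (polyComb (fun k : Fin n => (X : ℂ[X]) ^ (k : ℕ)) x).coeff j = x j := by
  rw [polyComb_apply, finsetSum_coeff, Finset.sum_eq_single j]
  · simp
  · intro k _ hk
    rw [coeff_smul, coeff_X_pow, if_neg (fun hh => hk (Fin.ext hh.symm)), smul_zero]
  · simp

theorem polyComb_X_pow_injective (n : ℕ) :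
    Function.Injective (polyComb (fun k : Fin n => (X : ℂ[X]) ^ (k : ℕ))) := by
  intro x y h
  ext j
  rw [← coeff_polyComb_X_pow, h, coeff_polyComb_X_pow]

theorem polyComb_X_pow_mem_degreeLT {n : ℕ} (x : EuclideanSpace ℂ (Fin n)) :
    polyComb (fun k : Fin n => (X : ℂ[X]) ^ (k : ℕ)) x ∈ degreeLT ℂ n := by
  rw [polyComb_apply]
  exact Submodule.sum_mem _ fun k _ => Submodule.smul_mem _ _ (by
    rw [mem_degreeLT, degree_X_pow]; exact_mod_cast k.2)

theorem polyComb_X_pow_coeff {n : ℕ} {p : ℂ[X]} (hp : p ∈ degreeLT ℂ n) :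
    polyComb (fun k : Fin n => (X : ℂ[X]) ^ (k : ℕ)) (WithLp.toLp 2 fun k => p.coeff k) = p := by
  ext j
  rcases lt_or_ge j n with hj | hj
  · exact coeff_polyComb_X_pow _ ⟨j, hj⟩
  · have h : ∀ r ∈ degreeLT ℂ n, r.coeff j = 0 := fun r hr =>
      coeff_eq_zero_of_degree_lt ((mem_degreeLT.1 hr).trans_le (by exact_mod_cast hj))
    rw [h _ (polyComb_X_pow_mem_degreeLT _), h p hp]

/-- The Hankel matrix `Λ (X ^ (j + k))` of a linear functional on polynomials. -/
noncomputable def hankelMap (n : ℕ) (Λ : ℂ[X] →ₗ[ℂ] ℂ) :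
    EuclideanSpace ℂ (Fin n) →ₗ[ℂ] EuclideanSpace ℂ (Fin n) where
  toFun x := WithLp.toLp 2 fun j : Fin n =>
    Λ (X ^ (j : ℕ) * polyComb (fun k : Fin n => (X : ℂ[X]) ^ (k : ℕ)) x)
  map_add' x y := by ext j; simp [mul_add]
  map_smul' a x := by ext j; simp

theorem inner_hankelMap {n : ℕ} (Λ : ℂ[X] →ₗ[ℂ] ℂ) (x y : EuclideanSpace ℂ (Fin n)) :
    inner ℂ x (hankelMap n Λ y) =
      Λ (conjPoly (polyComb (fun k : Fin n => (X : ℂ[X]) ^ (k : ℕ)) x) *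
        polyComb (fun k : Fin n => (X : ℂ[X]) ^ (k : ℕ)) y) := by
  have h : conjPoly (polyComb (fun k : Fin n => (X : ℂ[X]) ^ (k : ℕ)) x) =
      ∑ k : Fin n, (starRingEnd ℂ) (x k) • (X : ℂ[X]) ^ (k : ℕ) := by
    rw [polyComb_apply, conjPoly, Polynomial.map_sum]
    simp [smul_eq_C_mul]
  rw [h, Finset.sum_mul, map_sum, PiLp.inner_apply]
  refine Finset.sum_congr rfl fun k _ => ?_
  rw [smul_mul_assoc, map_smul, smul_eq_mul]
  simp [hankelMap, mul_comm]

theorem isSymmetric_hankelMap {n : ℕ} {Λ : ℂ[X] →ₗ[ℂ] ℂ}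
    (hΛ : ∀ f, Λ (conjPoly f) = (starRingEnd ℂ) (Λ f)) : (hankelMap n Λ).IsSymmetric := by
  intro x y
  rw [← inner_conj_symm, inner_hankelMap, inner_hankelMap, ← hΛ, conjPoly_mul,
    conjPoly_conjPoly, mul_comm]

/-- Compactness of the unit sphere of `V`. The margin `δ` is what the `L²(-1, 1)` term is later
allowed to consume. -/
theorem exists_le_neg_mul_norm_sq {H : Type*} [NormedAddCommGroup H] [InnerProductSpace ℂ H]
    [FiniteDimensional ℂ H] (T : H →L[ℂ] H) (V : Submodule ℂ H)
    (hV : ∀ x ∈ V, x ≠ 0 → (inner ℂ x (T x)).re < 0) :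
    ∃ δ : ℝ, 0 < δ ∧ ∀ x ∈ V, (inner ℂ x (T x)).re ≤ -δ * ‖x‖ ^ 2 := by
  have : ProperSpace H := FiniteDimensional.proper ℂ H
  set S : Set H := Metric.sphere 0 1 ∩ V
  have hS : IsCompact S := (isCompact_sphere 0 1).inter_right V.closed_of_finiteDimensional
  have hf : Continuous fun x : H => (inner ℂ x (T x)).re :=
    Complex.continuous_re.comp (by fun_prop)
  have hscale : ∀ x ∈ V, x ≠ 0 → ((‖x‖⁻¹ : ℝ) : ℂ) • x ∈ S := fun x hx hx0 => by
    refine ⟨?_, V.smul_mem _ hx⟩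
    rw [mem_sphere_zero_iff_norm, norm_smul, Complex.norm_real, norm_inv, norm_norm,
      inv_mul_cancel₀ (norm_ne_zero_iff.2 hx0)]
  rcases S.eq_empty_or_nonempty with he | hne
  · refine ⟨1, one_pos, fun x hx => ?_⟩
    by_cases hx0 : x = 0
    · simp [hx0]
    · exact absurd (hscale x hx hx0) (by rw [he]; exact Set.notMem_empty _)
  · obtain ⟨y, hy, hmax⟩ := hS.exists_isMaxOn hne hf.continuousOn
    have hy0 : y ≠ 0 := fun h0 => by
      have := hy.1; rw [h0, mem_sphere_zero_iff_norm, norm_zero] at this; norm_num at this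
    refine ⟨-(inner ℂ y (T y)).re, neg_pos.2 (hV y hy.2 hy0), fun x hx => ?_⟩
    by_cases hx0 : x = 0
    · simp [hx0]
    have h1 : (inner ℂ (((‖x‖⁻¹ : ℝ) : ℂ) • x) (T (((‖x‖⁻¹ : ℝ) : ℂ) • x))).re ≤
      (inner ℂ y (T y)).re := hmax (hscale x hx hx0)
    rw [map_smul, inner_smul_left, inner_smul_right, Complex.conj_ofReal, Complex.re_ofReal_mul,
      Complex.re_ofReal_mul] at h1
    have hn : 0 < ‖x‖ := norm_pos_iff.2 hx0
    have h2 : (inner ℂ x (T x)).re = ‖x‖ ^ 2 * (‖x‖⁻¹ * (‖x‖⁻¹ * (inner ℂ x (T x)).re)) := by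
      field_simp
    rw [h2, neg_neg, mul_comm]
    exact mul_le_mul_of_nonneg_right h1 (by positivity)

theorem integral_norm_polyComb_sq_le {n : ℕ} (g : Fin n → ℂ[X]) (x : EuclideanSpace ℂ (Fin n)) :
    ∫ t in (-1 : ℝ)..1, ‖(polyComb g x).eval (t : ℂ)‖ ^ 2 ≤
      ‖x‖ ^ 2 * ∑ k, ∫ t in (-1 : ℝ)..1, ‖(g k).eval (t : ℂ)‖ ^ 2 := by
  have hc : ∀ p : ℂ[X], Continuous fun t : ℝ => ‖p.eval (t : ℂ)‖ ^ 2 :=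
    fun p => (continuous_eval_ofReal p).norm.pow 2
  rw [← intervalIntegral.integral_finsetSum fun k _ => (hc (g k)).intervalIntegrable _ _,
    ← intervalIntegral.integral_const_mul]
  refine intervalIntegral.integral_mono_on (by norm_num) ((hc _).intervalIntegrable _ _)
    ((continuous_const.mul (continuous_finsetSum _ fun k _ => hc (g k))).intervalIntegrable _ _)
    fun t _ => ?_
  have h1 : ‖(polyComb g x).eval (t : ℂ)‖ ≤ ∑ k, ‖x k‖ * ‖(g k).eval (t : ℂ)‖ := by
    rw [polyComb_apply, eval_finsetSum]
    refine (norm_sum_le _ _).trans (Finset.sum_le_sum fun k _ => ?_)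
    rw [eval_smul, smul_eq_mul, norm_mul]
  refine (pow_le_pow_left₀ (norm_nonneg _) h1 2).trans ?_
  rw [EuclideanSpace.norm_sq_eq]
  exact Finset.sum_mul_sq_le_sq_mul_sq _ _ _

end HankelMatrix

namespace IsNodalFunctional

open Polynomial

variable {ι : Type*} [Fintype ι] {β : ι → ℂ} {K : ι → ℕ} {c : ι → ℂ} {L : ι → ℂ[X] →ₗ[ℂ] ℂ}

/-- Here `n` is the degree of the node polynomial `q`. A kernel vector is a polynomial of degree
below `n` orthogonal to all such polynomials, hence to everything by division modulo `q`. So `q`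
divides it. -/
theorem hankelMap_injective (h : IsNodalFunctional β K c L) {n : ℕ} (hn : ∑ i, (K i + 1) = n)
    (x : EuclideanSpace ℂ (Fin n)) (hx : hankelMap n (∑ i, L i) x = 0) : x = 0 := by
  set q := nodePoly β fun i => K i + 1
  have hqm : q.Monic := monic_nodePoly _ _
  have hqd : q.natDegree = n := (natDegree_nodePoly _ _).trans hn
  set p := polyComb (fun k : Fin n => (X : ℂ[X]) ^ (k : ℕ)) x
  have hpd : p ∈ degreeLT ℂ n := polyComb_X_pow_mem_degreeLT x
  have hdvd : q ∣ p := by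
    refine h.nodePoly_dvd_of_forall fun v => ?_
    have h1 : p * v = q * (p * (v /ₘ q)) + conjPoly (conjPoly (v %ₘ q)) * p := by
      conv_lhs => rw [← modByMonic_add_div v q]
      rw [conjPoly_conjPoly]
      ring
    have h2 : conjPoly (v %ₘ q) ∈ degreeLT ℂ n := by
      rw [mem_degreeLT, conjPoly, Polynomial.degree_map, ← hqd,
        ← degree_eq_natDegree hqm.ne_zero]
      exact degree_modByMonic_lt v hqm
    have h3 := inner_hankelMap (∑ i, L i) (WithLp.toLp 2 fun k => (conjPoly (v %ₘ q)).coeff k) x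
    rw [hx, inner_zero_right, polyComb_X_pow_coeff h2, LinearMap.sum_apply] at h3
    simp only [h1, map_add, Finset.sum_add_distrib]
    rw [h.sum_apply_eq_zero_of_dvd (dvd_mul_right _ _), zero_add]
    exact h3.symm
  have hp0 : p = 0 := by
    by_contra hp
    have h1 := natDegree_le_of_dvd hdvd hp
    rw [hqd] at h1
    rw [mem_degreeLT, degree_eq_natDegree hp] at hpd
    exact absurd (by exact_mod_cast hpd) (not_lt.2 h1)
  exact polyComb_X_pow_injective n (hp0.trans (map_zero _).symm)

theorem exists_polyComb_neg (h : IsNodalFunctional β K c L) :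
    ∃ (n : ℕ) (V : Submodule ℂ (EuclideanSpace ℂ (Fin n))) (g : Fin n → ℂ[X]),
      ∑ i, negMultiplicity β K c i ≤ Module.finrank ℂ V ∧
      ∀ x ∈ V, x ≠ 0 → (∑ i, L i (polyComb g x * conjPoly (polyComb g x))).re +
        ∫ t in (-1 : ℝ)..1, ‖(polyComb g x).eval (t : ℂ)‖ ^ 2 < 0 := by
  set n := ∑ i, (K i + 1) with hn
  set q := nodePoly β fun i => K i + 1
  have hqm : q.Monic := monic_nodePoly _ _
  set Λ : ℂ[X] →ₗ[ℂ] ℂ := ∑ i, L i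
  have hΛ : ∀ f, Λ f = ∑ i, L i f := fun f => LinearMap.sum_apply _ _ _
  have hΛc : ∀ f, Λ (conjPoly f) = (starRingEnd ℂ) (Λ f) := fun f => by
    rw [hΛ, hΛ, h.sum_conjPoly]
  set ev := polyComb (fun k : Fin n => (X : ℂ[X]) ^ (k : ℕ))
  set T : EuclideanSpace ℂ (Fin n) →L[ℂ] EuclideanSpace ℂ (Fin n) :=
    LinearMap.toContinuousLinearMap (hankelMap n Λ)
  have hT : (T : EuclideanSpace ℂ (Fin n) →ₗ[ℂ] _).IsSymmetric := isSymmetric_hankelMap hΛc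
  have hTin : ∀ x, inner ℂ x (T x) = Λ (ev x * conjPoly (ev x)) := fun x => by
    rw [mul_comm]; exact inner_hankelMap Λ x x
  -- a subspace on which the form is nonpositive
  set N := ∑ i, negMultiplicity β K c i
  set r := nodePoly β fun i => K i + 1 - negMultiplicity β K c i
  have hrm : r.Monic := monic_nodePoly _ _
  have hrd : r.natDegree + N = n := by
    rw [natDegree_nodePoly, ← Finset.sum_add_distrib]
    exact Finset.sum_congr rfl fun i _ => Nat.sub_add_cancel (h.negMultiplicity_le i)
  -- Multiplication by `r`; as `deg r + N = n`, the products still have degree below `n`.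
  let φ : degreeLT ℂ N →ₗ[ℂ] EuclideanSpace ℂ (Fin n) :=
    { toFun := fun p => WithLp.toLp 2 fun k : Fin n => (r * (p : ℂ[X])).coeff k
      map_add' := fun p p' => by ext k; simp [mul_add]
      map_smul' := fun a p => by ext k; simp }
  have hφ : ∀ p, ev (φ p) = r * (p : ℂ[X]) := fun p => by
    refine polyComb_X_pow_coeff ?_
    have hp := mem_degreeLT.1 p.2
    by_cases hp0 : (p : ℂ[X]) = 0
    · rw [hp0, mul_zero]; exact Submodule.zero_mem _
    rw [degree_eq_natDegree hp0] at hp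
    rw [mem_degreeLT, degree_mul, degree_eq_natDegree hp0, degree_eq_natDegree hrm.ne_zero,
      ← hrd]
    push_cast
    exact WithBot.add_lt_add_left (by simp) hp
  have hφi : Function.Injective φ := fun p p' hpp => by
    have := (hφ p).symm.trans ((congrArg ev hpp).trans (hφ p'))
    exact Subtype.ext (mul_left_cancel₀ hrm.ne_zero this)
  have hUdim : N = Module.finrank ℂ (LinearMap.range φ) := by
    rw [LinearMap.finrank_range_of_inj hφi, (degreeLTEquiv ℂ N).finrank_eq,
      Module.finrank_fin_fun]
  have hle := finrank_le_finrank_negEigenspace_of_nonpos hT (h.hankelMap_injective hn.symm)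
    (U := LinearMap.range φ) (by
      rintro _ ⟨p, rfl⟩
      rw [hTin, hφ, hΛ]
      exact h.re_nonpos_of_sub_negMultiplicity (dvd_mul_right _ _))
  obtain ⟨δ, hδ, hneg⟩ := exists_le_neg_mul_norm_sq T (negEigenspace T)
    fun x hx hx0 => inner_map_self_neg_of_mem_negEigenspace hT hx hx0
  -- The `n` errors add up to less than the margin `δ`; the denominator `n + 1` also covers `n = 0`.
  choose f hf using fun k : Fin n => exists_integral_norm_sub_mul_sq_lt (X ^ (k : ℕ))
    hqm.ne_zero (show 0 < δ / (n + 1) by positivity)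
  refine ⟨n, negEigenspace T, fun k => X ^ (k : ℕ) - q * f k, hUdim.trans_le hle,
    fun x hx hx0 => ?_⟩
  have hg : polyComb (fun k : Fin n => (X : ℂ[X]) ^ (k : ℕ) - q * f k) x =
      ev x - q * polyComb f x := by
    simp only [ev, polyComb_apply, smul_sub, Finset.sum_sub_distrib, Finset.mul_sum,
      mul_smul_comm]
  -- Since `q` divides `q*`, corrections by multiples of `q` in either factor are invisible to the
  -- functional.
  have hsame : ∑ i, L i (polyComb (fun k : Fin n => (X : ℂ[X]) ^ (k : ℕ) - q * f k) x *
      conjPoly (polyComb (fun k : Fin n => (X : ℂ[X]) ^ (k : ℕ) - q * f k) x)) =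
      inner ℂ x (T x) := by
    obtain ⟨s, hs⟩ := h.nodePoly_dvd_conjPoly
    set w := polyComb f x
    have h1 : (ev x - q * w) * conjPoly (ev x - q * w) = ev x * conjPoly (ev x) -
        q * (w * conjPoly (ev x - q * w) + ev x * (s * conjPoly w)) := by
      have h2 : conjPoly (ev x - q * w) = conjPoly (ev x) - q * s * conjPoly w := by
        rw [← hs, ← conjPoly_mul]; exact Polynomial.map_sub _
      rw [h2]; ring
    rw [hg, h1, hTin, ← hΛ, map_sub, hΛ (q * _), h.sum_apply_eq_zero_of_dvd (dvd_mul_right _ _),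
      sub_zero]
  rw [hsame]
  have h1 := hneg x hx
  have h2 := integral_norm_polyComb_sq_le (fun k : Fin n => (X : ℂ[X]) ^ (k : ℕ) - q * f k) x
  have h3 : ∑ k : Fin n, ∫ t in (-1 : ℝ)..1, ‖((X : ℂ[X]) ^ (k : ℕ) - q * f k).eval (t : ℂ)‖ ^ 2
      ≤ n * (δ / (n + 1)) := by
    refine (Finset.sum_le_sum fun k _ => (hf k).le).trans ?_
    simp
  have h4 : (n : ℝ) * (δ / (n + 1)) < δ := by
    rw [mul_div_assoc', div_lt_iff₀ (by positivity)]
    nlinarith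
  have hxp : 0 < ‖x‖ ^ 2 := by positivity
  nlinarith

end IsNodalFunctional

/-! ### Moment functionals of polynomials and poles on the circle -/

section CircleIntegrals

open Polynomial

/-- The point of the unit circle in `ℂ` with parameter `t`. -/
noncomputable def circleVal (t : UnitAddCircle) : ℂ := (AddCircle.toCircle t : ℂ)

theorem norm_circleVal (t : UnitAddCircle) : ‖circleVal t‖ = 1 := Circle.norm_coe _

theorem circleVal_neg (t : UnitAddCircle) : circleVal (-t) = (starRingEnd ℂ) (circleVal t) := by
  rw [circleVal, AddCircle.toCircle_neg, Circle.coe_inv_eq_conj]; rfl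

theorem circleVal_mul_circleVal_neg (t : UnitAddCircle) : circleVal t * circleVal (-t) = 1 := by
  rw [circleVal_neg, Complex.mul_conj', norm_circleVal]; simp

theorem continuous_circleVal : Continuous circleVal :=
  continuous_subtype_val.comp AddCircle.continuous_toCircle

theorem continuous_circleVal_neg : Continuous fun t : UnitAddCircle => circleVal (-t) :=
  continuous_circleVal.comp continuous_neg

theorem fourier_eq_circleVal_pow (k : ℕ) (t : UnitAddCircle) :
    fourier (T := (1 : ℝ)) (k : ℤ) t = circleVal t ^ k := by
  rw [fourier_apply, natCast_zsmul, AddCircle.toCircle_nsmul]; rfl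

theorem fourier_neg_eq_circleVal_pow (k : ℕ) (t : UnitAddCircle) :
    fourier (T := (1 : ℝ)) (-(k : ℤ)) t = circleVal (-t) ^ k := by
  rw [fourier_neg, fourier_eq_circleVal_pow, circleVal_neg, map_pow]

theorem continuous_eval_circleVal_neg (f : ℂ[X]) :
    Continuous fun t : UnitAddCircle => f.eval (circleVal (-t)) :=
  f.continuous.comp continuous_circleVal_neg

theorem Continuous.integrable_haarAddCircle {s : UnitAddCircle → ℂ} (hs : Continuous s) :
    Integrable s AddCircle.haarAddCircle :=
  hs.integrable_of_hasCompactSupport (HasCompactSupport.of_compactSpace s)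

theorem integrable_mul_eval {s : UnitAddCircle → ℂ} (hs : Integrable s AddCircle.haarAddCircle)
    (f : ℂ[X]) :
    Integrable (fun t => s t * f.eval (circleVal (-t))) AddCircle.haarAddCircle := by
  have hc := continuous_eval_circleVal_neg f
  obtain ⟨B, hB⟩ := isCompact_univ.exists_bound_of_continuousOn hc.continuousOn
  exact hs.mul_bdd hc.aestronglyMeasurable
    (Filter.Eventually.of_forall fun t => hB t (Set.mem_univ t))

/-- The functional `f ↦ ∫ s(μ) f(μ̄) dm(μ)` on polynomials. -/
noncomputable def circleFunctional (s : UnitAddCircle → ℂ)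
    (hs : Integrable s AddCircle.haarAddCircle) : ℂ[X] →ₗ[ℂ] ℂ where
  toFun f := ∫ t, s t * f.eval (circleVal (-t)) ∂AddCircle.haarAddCircle
  map_add' f g := by
    simp only [eval_add, mul_add]
    exact integral_add (integrable_mul_eval hs f) (integrable_mul_eval hs g)
  map_smul' a f := by
    simp only [eval_smul, smul_eq_mul, RingHom.id_apply]
    rw [← integral_const_mul]
    congr 1; ext t; ring

theorem integral_circleVal_neg_pow {k : ℕ} (hk : k ≠ 0) :
    ∫ t : UnitAddCircle, circleVal (-t) ^ k ∂AddCircle.haarAddCircle = 0 := by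
  simp_rw [← fourier_neg_eq_circleVal_pow]
  exact integral_eq_zero_of_add_right_eq_neg (μ := AddCircle.haarAddCircle)
    (fourier_add_half_inv_index (by simpa using hk) one_pos)

theorem integral_eval_circleVal_neg (f : ℂ[X]) :
    ∫ t : UnitAddCircle, f.eval (circleVal (-t)) ∂AddCircle.haarAddCircle = f.eval 0 := by
  induction f using Polynomial.induction_on' with
  | add p q hp hq =>
    simp only [eval_add]
    rw [integral_add (continuous_eval_circleVal_neg p).integrable_haarAddCircle
      (continuous_eval_circleVal_neg q).integrable_haarAddCircle, hp, hq]
  | monomial k a =>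
    simp only [eval_monomial]
    rw [integral_const_mul]
    rcases eq_or_ne k 0 with rfl | hk
    · simp
    · rw [integral_circleVal_neg_pow hk, zero_pow hk]

theorem integral_circleVal_neg_mul_eval (f : ℂ[X]) :
    ∫ t : UnitAddCircle, circleVal (-t) * f.eval (circleVal (-t)) ∂AddCircle.haarAddCircle = 0 := by
  have := integral_eval_circleVal_neg (X * f)
  simpa using this

/-- Each factor `μ̄` cancels one power of `μ` in `R`; the constant term split off at each step
integrates to zero against `μ̄ g(μ̄)`. -/
theorem integral_eval_mul_pow_mul_eval (n : ℕ) :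
    ∀ (R f : ℂ[X]), R.natDegree ≤ n →
      ∫ t : UnitAddCircle, R.eval (circleVal t) * (X ^ n * f).eval (circleVal (-t))
        ∂AddCircle.haarAddCircle = R.coeff n * f.eval 0 := by
  induction n with
  | zero =>
    intro R f hR
    rw [eq_C_of_natDegree_le_zero hR]
    simp only [eval_C, pow_zero, one_mul, coeff_C_zero]
    rw [integral_const_mul, integral_eval_circleVal_neg]
  | succ n ih =>
    intro R f hR
    have hpt : ∀ t : UnitAddCircle,
        R.eval (circleVal t) * (X ^ (n + 1) * f).eval (circleVal (-t)) =
        R.divX.eval (circleVal t) * (X ^ n * f).eval (circleVal (-t)) +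
          R.coeff 0 * (circleVal (-t) * (X ^ n * f).eval (circleVal (-t))) := fun t => by
      have h1 : R.eval (circleVal t) = R.divX.eval (circleVal t) * circleVal t + R.coeff 0 := by
        conv_lhs => rw [← divX_mul_X_add R]
        simp
      rw [h1]
      simp only [eval_mul, eval_pow, eval_X]
      linear_combination (R.divX.eval (circleVal t) * circleVal (-t) ^ n *
        f.eval (circleVal (-t))) * circleVal_mul_circleVal_neg t
    simp_rw [hpt]
    rw [integral_add, integral_const_mul, integral_circleVal_neg_mul_eval, mul_zero, add_zero,
      ih _ _ (by rw [natDegree_divX_eq_natDegree_tsub_one]; omega), coeff_divX]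
    · exact ((R.divX.continuous.comp continuous_circleVal).mul
        (continuous_eval_circleVal_neg _)).integrable_haarAddCircle
    · exact (continuous_const.mul (continuous_circleVal_neg.mul
        (continuous_eval_circleVal_neg _))).integrable_haarAddCircle

theorem circleVal_sub_ne_zero {γ : ℂ} (hγ : 1 < ‖γ‖) (t : UnitAddCircle) :
    circleVal t - γ ≠ 0 := fun h => by
  rw [← sub_eq_zero.1 h, norm_circleVal] at hγ
  exact lt_irrefl _ hγ

/-- The moments `a k = ∫ μ^k / (μ - γ)` satisfy `a (k + 1) = γ a k` for `k ≥ 1` and are bounded, so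
`|γ| > 1` forces `a 1 = 0`. The step from `a 0` to `a 1` then gives the value. -/
theorem integral_circleVal_sub_inv {γ : ℂ} (hγ : 1 < ‖γ‖) :
    ∫ t : UnitAddCircle, (circleVal t - γ)⁻¹ ∂AddCircle.haarAddCircle = -γ⁻¹ := by
  have hne := circleVal_sub_ne_zero hγ
  have hγ0 : γ ≠ 0 := fun h => by rw [h, norm_zero] at hγ; linarith
  set a : ℕ → ℂ := fun k =>
    ∫ t : UnitAddCircle, circleVal t ^ k * (circleVal t - γ)⁻¹ ∂AddCircle.haarAddCircle with ha
  have hcont : ∀ k, Continuous fun t : UnitAddCircle => circleVal t ^ k * (circleVal t - γ)⁻¹ :=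
    fun k => (continuous_circleVal.pow k).mul
      ((continuous_circleVal.sub continuous_const).inv₀ hne)
  have hpow : ∀ k : ℕ, k ≠ 0 →
      ∫ t : UnitAddCircle, circleVal t ^ k ∂AddCircle.haarAddCircle = 0 := fun k hk => by
    simp_rw [← fourier_eq_circleVal_pow]
    exact integral_eq_zero_of_add_right_eq_neg (μ := AddCircle.haarAddCircle)
      (fourier_add_half_inv_index (by simpa using hk) one_pos)
  have hrec : ∀ k, a (k + 1) = γ * a k +
      ∫ t : UnitAddCircle, circleVal t ^ k ∂AddCircle.haarAddCircle := fun k => by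
    rw [ha]
    simp only
    have hpc : Continuous fun t : UnitAddCircle => circleVal t ^ k := continuous_circleVal.pow k
    rw [← integral_const_mul, ← integral_add ((hcont k).const_mul γ).integrable_haarAddCircle
      hpc.integrable_haarAddCircle]
    congr 1
    ext t
    field_simp [hne t]
    ring
  have hgeom : ∀ k, a (k + 1) = γ ^ k * a 1 := by
    intro k
    induction k with
    | zero => simp
    | succ k ih => rw [hrec, hpow _ (Nat.succ_ne_zero k), ih]; ring
  have hbound : ∀ k, ‖a k‖ ≤ (‖γ‖ - 1)⁻¹ := fun k => by
    have := norm_integral_le_of_norm_le_const (μ := AddCircle.haarAddCircle (T := (1 : ℝ)))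
      (f := fun t => circleVal t ^ k * (circleVal t - γ)⁻¹) (C := (‖γ‖ - 1)⁻¹)
      (Filter.Eventually.of_forall fun t => by
        rw [norm_mul, norm_pow, norm_circleVal, one_pow, one_mul, norm_inv]
        refine inv_anti₀ (by linarith) ?_
        have := norm_sub_norm_le γ (circleVal t)
        rw [norm_circleVal, norm_sub_rev] at this
        exact this)
    simpa using this
  have ha1 : a 1 = 0 := by
    by_contra h0
    have hpos : 0 < ‖a 1‖ := norm_pos_iff.2 h0
    obtain ⟨k, hk⟩ := pow_unbounded_of_one_lt ((‖γ‖ - 1)⁻¹ / ‖a 1‖) hγ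
    have := hbound (k + 1)
    rw [hgeom, norm_mul, norm_pow] at this
    rw [div_lt_iff₀ hpos] at hk
    linarith
  have h1 := hrec 0
  rw [zero_add, ha1] at h1
  simp only [pow_zero] at h1
  have h0 : a 0 = ∫ t : UnitAddCircle, (circleVal t - γ)⁻¹ ∂AddCircle.haarAddCircle := by
    simp [ha]
  rw [← h0]
  have h2 : γ * a 0 = -1 := by
    have h3 : ∫ _ : UnitAddCircle, (1 : ℂ) ∂AddCircle.haarAddCircle = 1 := by simp
    rw [h3] at h1
    linear_combination -h1
  field_simp
  linear_combination h2

theorem continuous_pole {γ : ℂ} (hγ : 1 < ‖γ‖) (R : ℂ[X]) (n : ℕ) :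
    Continuous fun t : UnitAddCircle => R.eval (circleVal t) / (circleVal t - γ) ^ n :=
  (R.continuous.comp continuous_circleVal).div
    ((continuous_circleVal.sub continuous_const).pow n)
    fun t => pow_ne_zero _ (circleVal_sub_ne_zero hγ t)

/-- On the circle `μ̄ - γ⁻¹ = -γ⁻¹ μ̄ (μ - γ)`, so each zero at `γ⁻¹` lowers the order of the pole
by one. -/
theorem integral_pole_mul_eval {γ : ℂ} (hγ : 1 < ‖γ‖) (n : ℕ) :
    ∀ (R f : ℂ[X]), R.natDegree ≤ n →
      ∫ t : UnitAddCircle, R.eval (circleVal t) / (circleVal t - γ) ^ (n + 1) *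
          ((X - C γ⁻¹) ^ n * f).eval (circleVal (-t)) ∂AddCircle.haarAddCircle =
        (-(γ⁻¹) ^ 2) ^ n * (-γ⁻¹) * R.eval γ * f.eval γ⁻¹ := by
  have hne := circleVal_sub_ne_zero hγ
  have hγ0 : γ ≠ 0 := fun h => by rw [h, norm_zero] at hγ; linarith
  have hker : ∀ t : UnitAddCircle,
      circleVal (-t) - γ⁻¹ = -γ⁻¹ * circleVal (-t) * (circleVal t - γ) := fun t => by
    have h1 := circleVal_mul_circleVal_neg t
    have h2 : γ⁻¹ * γ = 1 := inv_mul_cancel₀ hγ0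
    linear_combination γ⁻¹ * h1 - circleVal (-t) * h2
  induction n with
  | zero =>
    intro R f hR
    rw [eq_C_of_natDegree_le_zero hR]
    set r := R.coeff 0
    obtain ⟨g, hg⟩ := X_sub_C_dvd_sub_C_eval (a := γ⁻¹) (p := f)
    have hf : f = C (f.eval γ⁻¹) + (X - C γ⁻¹) * g := by rw [← hg]; ring
    have hpt : ∀ t : UnitAddCircle,
        (C r).eval (circleVal t) / (circleVal t - γ) ^ (0 + 1) *
          ((X - C γ⁻¹) ^ 0 * f).eval (circleVal (-t)) =
        (r * f.eval γ⁻¹) * (circleVal t - γ)⁻¹ +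
          (-(r * γ⁻¹)) * (circleVal (-t) * g.eval (circleVal (-t))) := fun t => by
      have h1 : f.eval (circleVal (-t)) =
          f.eval γ⁻¹ + (circleVal (-t) - γ⁻¹) * g.eval (circleVal (-t)) := by
        conv_lhs => rw [hf]
        simp
      rw [pow_zero, one_mul, h1, hker, eval_C, zero_add, pow_one, div_eq_mul_inv]
      have h2 : (circleVal t - γ)⁻¹ * (circleVal t - γ) = 1 := inv_mul_cancel₀ (hne t)
      linear_combination (-r * γ⁻¹ * circleVal (-t) * g.eval (circleVal (-t))) * h2
    simp_rw [hpt]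
    rw [integral_add, integral_const_mul, integral_const_mul, integral_circleVal_neg_mul_eval,
      integral_circleVal_sub_inv hγ, eval_C]
    · ring
    · exact (((continuous_circleVal.sub continuous_const).inv₀ hne).const_mul _).integrable_haarAddCircle
    · exact ((continuous_circleVal_neg.mul
        (continuous_eval_circleVal_neg _)).const_mul _).integrable_haarAddCircle
  | succ n ih =>
    intro R f hR
    -- Makes `S(0) = 0`, so that the extra `μ̄` is absorbed by `S.divX`; the subtracted term leaves
    -- a multiple of `μ̄ g(μ̄)`, which integrates to zero.
    set a : ℂ := -γ⁻¹ * R.eval 0 / (-γ) ^ (n + 1)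
    set S : ℂ[X] := C (-γ⁻¹) * R - C a * (X - C γ) ^ (n + 1)
    have hS0 : S.coeff 0 = 0 := by
      rw [coeff_zero_eq_eval_zero]
      simp only [S, a, eval_sub, eval_mul, eval_C, eval_pow, eval_X, zero_sub]
      field_simp [pow_ne_zero (n + 1) (neg_ne_zero.2 hγ0)]
      ring
    have hSdeg : S.natDegree ≤ n + 1 := by
      refine (natDegree_sub_le _ _).trans (max_le ?_ ?_)
      · exact (natDegree_C_mul_le _ _).trans hR
      · refine (natDegree_C_mul_le _ _).trans ?_
        rw [natDegree_pow, natDegree_X_sub_C, mul_one]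
    have hSX : S = S.divX * X := by
      conv_lhs => rw [← divX_mul_X_add S, hS0, map_zero, add_zero]
    have hSev : ∀ z, S.divX.eval z * z = -γ⁻¹ * R.eval z - a * (z - γ) ^ (n + 1) := fun z => by
      have : S.eval z = S.divX.eval z * z := by
        conv_lhs => rw [hSX]
        simp
      rw [← this]
      simp [S]
    have hSγ : S.divX.eval γ = -(γ⁻¹) ^ 2 * R.eval γ := by
      have := hSev γ
      rw [sub_self, zero_pow (Nat.succ_ne_zero n), mul_zero, sub_zero] at this
      field_simp at this ⊢
      linear_combination this
    have hpt : ∀ t : UnitAddCircle,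
        R.eval (circleVal t) / (circleVal t - γ) ^ (n + 1 + 1) *
          ((X - C γ⁻¹) ^ (n + 1) * f).eval (circleVal (-t)) =
        S.divX.eval (circleVal t) / (circleVal t - γ) ^ (n + 1) *
          ((X - C γ⁻¹) ^ n * f).eval (circleVal (-t)) +
        a * (circleVal (-t) * ((X - C γ⁻¹) ^ n * f).eval (circleVal (-t))) := fun t => by
      have h1 : R.eval (circleVal t) / (circleVal t - γ) ^ (n + 1 + 1) *
          (circleVal (-t) - γ⁻¹) =
          S.divX.eval (circleVal t) / (circleVal t - γ) ^ (n + 1) + a * circleVal (-t) := by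
        have h2 : S.divX.eval (circleVal t) =
            (-γ⁻¹ * R.eval (circleVal t) - a * (circleVal t - γ) ^ (n + 1)) *
              circleVal (-t) := by
          rw [← hSev]
          linear_combination (-S.divX.eval (circleVal t)) * circleVal_mul_circleVal_neg t
        have hp : (circleVal t - γ) ^ (n + 1) ≠ 0 := pow_ne_zero _ (hne t)
        rw [hker, h2, pow_succ (circleVal t - γ) (n + 1)]
        field_simp [hne t, hp]
        ring
      simp only [eval_mul, eval_pow, eval_sub, eval_X, eval_C]
      linear_combination ((circleVal (-t) - γ⁻¹) ^ n * f.eval (circleVal (-t))) * h1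
    simp_rw [hpt]
    rw [integral_add, integral_const_mul, integral_circleVal_neg_mul_eval, mul_zero, add_zero,
      ih _ _ (by rw [natDegree_divX_eq_natDegree_tsub_one]; omega), hSγ]
    · ring
    · exact ((continuous_pole hγ _ _).mul
        (continuous_eval_circleVal_neg _)).integrable_haarAddCircle
    · exact ((continuous_circleVal_neg.mul
        (continuous_eval_circleVal_neg _)).const_mul _).integrable_haarAddCircle

end CircleIntegrals

/-! ### Moments of the Carleman symbol -/

section Carleman

open Polynomial

/-- The factor `μ⁻¹` shifts the index: the moment is the Fourier coefficient number `k + 1` of the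
square wave `π i sgn Im μ`, computed on the half-periods where the sign is constant. -/
theorem integral_carlemanSymbol_mul_pow (k : ℕ) :
    ∫ t : UnitAddCircle, carlemanSymbol (AddCircle.toCircle t) * circleVal (-t) ^ k
      ∂AddCircle.haarAddCircle = ((∫ x in (-1 : ℝ)..1, x ^ k : ℝ) : ℂ) := by
  set F : UnitAddCircle → ℂ := fun t =>
    (Real.pi : ℂ) * Complex.I * (Real.sign (circleVal t).im : ℂ)
  set c : ℂ := -(2 * Real.pi * Complex.I * ((k : ℂ) + 1)) with hc
  have hk : (k : ℂ) + 1 ≠ 0 := by exact_mod_cast Nat.succ_ne_zero k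
  have hpi : (Real.pi : ℂ) ≠ 0 := by exact_mod_cast Real.pi_ne_zero
  have hc0 : c ≠ 0 :=
    neg_ne_zero.2 (mul_ne_zero (mul_ne_zero (mul_ne_zero two_ne_zero hpi) Complex.I_ne_zero) hk)
  have h1 : ∫ t : UnitAddCircle, carlemanSymbol (AddCircle.toCircle t) * circleVal (-t) ^ k
      ∂AddCircle.haarAddCircle = fourierCoeff F ((k + 1 : ℕ) : ℤ) := by
    rw [fourierCoeff]
    congr 1
    ext t
    have h2 : ((AddCircle.toCircle t : Circle) : ℂ)⁻¹ = circleVal (-t) :=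
      inv_eq_of_mul_eq_one_right (circleVal_mul_circleVal_neg t)
    rw [fourier_neg_eq_circleVal_pow, carlemanSymbol, h2, smul_eq_mul]
    simp only [F, circleVal]
    ring
  have him : ∀ x : ℝ, (circleVal (x : UnitAddCircle)).im = Real.sin (2 * Real.pi * x) :=
    fun x => by
      rw [circleVal, AddCircle.toCircle_apply_mk, Circle.coe_exp, Complex.exp_ofReal_mul_I_im]
      simp
  have hfour : ∀ x : ℝ, fourier (T := (1 : ℝ)) (-((k + 1 : ℕ) : ℤ)) (x : UnitAddCircle) =
      Complex.exp (c * x) := fun x => by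
    rw [fourier_coe_apply]
    congr 1
    rw [hc]
    push_cast
    ring
  set f : ℝ → ℂ := fun x => fourier (T := (1 : ℝ)) (-((k + 1 : ℕ) : ℤ)) (x : UnitAddCircle) •
    F (x : UnitAddCircle) with hf
  have hpos : Set.EqOn f (fun x : ℝ => (Real.pi : ℂ) * Complex.I * Complex.exp (c * x))
      (Set.Ioo 0 (1 / 2)) := fun x hx => by
    have h3 : 0 < Real.sin (2 * Real.pi * x) := Real.sin_pos_of_pos_of_lt_pi
      (by have := Real.pi_pos; have := hx.1; positivity)
      (by have := Real.pi_pos; have := hx.2; nlinarith)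
    simp only [hf, F]
    rw [hfour, him, Real.sign_of_pos h3, smul_eq_mul]
    push_cast
    ring
  have hneg : Set.EqOn f (fun x : ℝ => -((Real.pi : ℂ) * Complex.I) * Complex.exp (c * x))
      (Set.Ioo (-(1 / 2)) 0) := fun x hx => by
    have h3 : Real.sin (2 * Real.pi * x) < 0 := Real.sin_neg_of_neg_of_neg_pi_lt
      (by have := Real.pi_pos; have := hx.2; nlinarith)
      (by have := Real.pi_pos; have := hx.1; nlinarith)
    simp only [hf, F]
    rw [hfour, him, Real.sign_of_neg h3, smul_eq_mul]
    push_cast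
    ring
  have hcont : ∀ a : ℂ, Continuous fun x : ℝ => a * Complex.exp (c * x) := fun a => by fun_prop
  have hi1 : IntervalIntegrable f volume 0 (1 / 2) :=
    (intervalIntegrable_congr_uIoo (by rw [Set.uIoo_of_le (by norm_num)]; exact hpos)).2
      ((hcont _).intervalIntegrable _ _)
  have hi2 : IntervalIntegrable f volume (-(1 / 2)) 0 :=
    (intervalIntegrable_congr_uIoo (by rw [Set.uIoo_of_le (by norm_num)]; exact hneg)).2
      ((hcont _).intervalIntegrable _ _)
  have hE1 : Complex.exp (c * ((1 / 2 : ℝ) : ℂ)) = (-1) ^ (k + 1) := by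
    rw [show c * ((1 / 2 : ℝ) : ℂ) = ((k + 1 : ℕ) : ℂ) * (-(Real.pi * Complex.I)) by
      rw [hc]; push_cast; ring, Complex.exp_nat_mul, Complex.exp_neg, Complex.exp_pi_mul_I]
    norm_num
  have hE2 : Complex.exp (c * ((-(1 / 2) : ℝ) : ℂ)) = (-1) ^ (k + 1) := by
    rw [show c * ((-(1 / 2) : ℝ) : ℂ) = ((k + 1 : ℕ) : ℂ) * (Real.pi * Complex.I) by
      rw [hc]; push_cast; ring, Complex.exp_nat_mul, Complex.exp_pi_mul_I]
  rw [h1, fourierCoeff_eq_intervalIntegral F _ (-(1 / 2)),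
    show (-(1 / 2) : ℝ) + 1 = 1 / 2 by norm_num,
    ← intervalIntegral.integral_add_adjacent_intervals hi2 hi1,
    intervalIntegral.integral_congr_Ioo_of_le (by norm_num) hneg,
    intervalIntegral.integral_congr_Ioo_of_le (by norm_num) hpos,
    intervalIntegral.integral_const_mul, intervalIntegral.integral_const_mul,
    integral_exp_mul_complex hc0, integral_exp_mul_complex hc0, hE1, hE2, integral_pow]
  simp only [Complex.ofReal_zero, mul_zero, Complex.exp_zero, one_pow]
  push_cast
  have hI : Complex.I ≠ 0 := Complex.I_ne_zero
  rw [hc, div_one, one_smul]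
  field_simp
  ring

theorem integral_carlemanSymbol_mul_eval
    (hs : Integrable (fun t : UnitAddCircle => carlemanSymbol (AddCircle.toCircle t))
      AddCircle.haarAddCircle) (f : ℂ[X]) :
    ∫ t : UnitAddCircle, carlemanSymbol (AddCircle.toCircle t) * f.eval (circleVal (-t))
      ∂AddCircle.haarAddCircle = ∫ x in (-1 : ℝ)..1, f.eval (x : ℂ) := by
  induction f using Polynomial.induction_on' with
  | add p q hp hq =>
    simp only [eval_add, mul_add]
    rw [integral_add (integrable_mul_eval hs p) (integrable_mul_eval hs q), hp, hq,
      intervalIntegral.integral_add ((continuous_eval_ofReal p).intervalIntegrable _ _)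
        ((continuous_eval_ofReal q).intervalIntegrable _ _)]
  | monomial k a =>
    have h1 : ∀ t : UnitAddCircle, carlemanSymbol (AddCircle.toCircle t) *
        (monomial k a).eval (circleVal (-t)) =
        a * (carlemanSymbol (AddCircle.toCircle t) * circleVal (-t) ^ k) := fun t => by
      rw [eval_monomial]; ring
    simp_rw [h1]
    rw [integral_const_mul, integral_carlemanSymbol_mul_pow, ← intervalIntegral.integral_ofReal]
    simp only [eval_monomial]
    rw [intervalIntegral.integral_const_mul]
    push_cast
    rfl

end Carleman

/-! ### Polynomials in the Hardy space -/

section HardyPolynomials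

open Polynomial

theorem fourierLp_mem_hardySpace (k : ℕ) :
    (fourierLp 2 (k : ℤ) : Lp ℂ 2 (AddCircle.haarAddCircle : Measure UnitAddCircle)) ∈
      hardySpace := by
  intro n hn
  rw [← fourierBasis_repr, ← coe_fourierBasis, HilbertBasis.repr_self]
  exact lp.single_apply_ne (E := fun _ : ℤ => ℂ) 2 _ _ (by omega)

theorem toLp_aeval_mem_hardySpace (p : ℂ[X]) :
    ContinuousMap.toLp (E := ℂ) 2 AddCircle.haarAddCircle ℂ
      (aeval (fourier (T := (1 : ℝ)) 1) p) ∈ hardySpace := by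
  induction p using Polynomial.induction_on' with
  | add p q hp hq =>
    rw [map_add, map_add]
    exact hardySpace.add_mem hp hq
  | monomial k a =>
    have h1 : (fourier (T := (1 : ℝ)) 1) ^ k = fourier (k : ℤ) := by
      ext t
      rw [ContinuousMap.pow_apply, fourier_eq_circleVal_pow, fourier_one]
      rfl
    rw [aeval_monomial, h1, ← Algebra.smul_def, map_smul]
    exact hardySpace.smul_mem _ (fourierLp_mem_hardySpace k)

/-- The polynomials as elements of the Hardy space. -/
noncomputable def polyToHardy : ℂ[X] →ₗ[ℂ] hardySpace :=
  LinearMap.codRestrict hardySpace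
    ((ContinuousMap.toLp (E := ℂ) 2 (AddCircle.haarAddCircle (T := (1 : ℝ))) ℂ).toLinearMap ∘ₗ
      (aeval (fourier (T := (1 : ℝ)) 1)).toLinearMap) toLp_aeval_mem_hardySpace

theorem coeFn_polyToHardy (p : ℂ[X]) :
    ((polyToHardy p : Lp ℂ 2 (AddCircle.haarAddCircle : Measure UnitAddCircle)) :
      UnitAddCircle → ℂ) =ᵐ[AddCircle.haarAddCircle] fun t => p.eval (circleVal t) := by
  have h := ContinuousMap.coeFn_toLp (E := ℂ) (p := 2) (𝕜 := ℂ)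
    (AddCircle.haarAddCircle (T := (1 : ℝ))) (aeval (fourier (T := (1 : ℝ)) 1) p)
  refine h.trans (Filter.Eventually.of_forall fun t => ?_)
  rw [Polynomial.aeval_continuousMap_apply, fourier_one]
  rfl

theorem coe_polyToHardy_X_pow (k : ℕ) :
    (polyToHardy (X ^ k) : Lp ℂ 2 (AddCircle.haarAddCircle : Measure UnitAddCircle)) =
      fourierBasis (k : ℤ) := by
  rw [coe_fourierBasis]
  change ContinuousMap.toLp (E := ℂ) 2 AddCircle.haarAddCircle ℂ
      (aeval (fourier (T := (1 : ℝ)) 1) (X ^ k)) = _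
  have h1 : (fourier (T := (1 : ℝ)) 1) ^ k = fourier (k : ℤ) := by
    ext t
    rw [ContinuousMap.pow_apply, fourier_eq_circleVal_pow, fourier_one]
    rfl
  rw [map_pow, aeval_X, h1]

theorem range_polyToHardy_orthogonal : (LinearMap.range polyToHardy)ᗮ = ⊥ := by
  rw [Submodule.eq_bot_iff]
  intro v hv
  have h1 : fourierBasis.repr (v : Lp ℂ 2 (AddCircle.haarAddCircle : Measure UnitAddCircle)) =
      0 := by
    ext n
    rw [lp.coeFn_zero, Pi.zero_apply]
    rcases lt_or_ge n 0 with hn | hn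
    · rw [fourierBasis_repr]
      exact v.2 n hn
    · lift n to ℕ using hn
      rw [HilbertBasis.repr_apply_apply, ← coe_polyToHardy_X_pow]
      exact hv _ ⟨X ^ n, rfl⟩
  exact Subtype.ext ((LinearIsometryEquiv.map_eq_zero_iff _).1 h1)

/-- `u(μ̄) conj(u(μ)) = (u u*)(μ̄)`, so the form depends only on the product `u u*`. -/
theorem inner_polyToHardy {G : hardySpace →L[ℂ] hardySpace} {σ : Circle → ℂ}
    (hG : IsHankelOperator G σ) (u : ℂ[X]) :
    inner ℂ (polyToHardy u) (G (polyToHardy u)) =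
      ∫ t : UnitAddCircle, σ (AddCircle.toCircle t) * (u * conjPoly u).eval (circleVal (-t))
        ∂AddCircle.haarAddCircle := by
  rw [hG.inner_eq]
  have h1 := coeFn_polyToHardy u
  have h2 := (Measure.measurePreserving_neg
    (AddCircle.haarAddCircle (T := (1 : ℝ)))).quasiMeasurePreserving.ae_eq_comp h1
  refine integral_congr_ae ?_
  filter_upwards [h1, h2] with t ht1 ht2
  simp only [Function.comp_apply] at ht2
  rw [ht1, ht2, eval_mul, eval_conjPoly, circleVal_neg, Complex.conj_conj]
  ring

end HardyPolynomials

/-! ### The count for an abstract nodal perturbation -/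

section SignCount

open Polynomial

theorem map_conjPoly_of_moments_real {Λ : ℂ[X] →ₗ[ℂ] ℂ} (h : ∀ k : ℕ, (Λ (X ^ k)).im = 0)
    (f : ℂ[X]) : Λ (conjPoly f) = (starRingEnd ℂ) (Λ f) := by
  induction f using Polynomial.induction_on' with
  | add p q hp hq => rw [conjPoly_add, map_add, hp, hq, map_add, map_add]
  | monomial k a =>
    have h1 : ∀ b : ℂ, (monomial k b : ℂ[X]) = b • X ^ k := fun b => by
      rw [smul_eq_C_mul, C_mul_X_pow_eq_monomial]
    rw [conjPoly, map_monomial, h1, h1, map_smul, map_smul, smul_eq_mul, smul_eq_mul, map_mul,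
      Complex.conj_eq_iff_im.2 (h k)]

/-- Testing on `X^j` gives the even moments, and testing on `X^j + X^(j+1)` then gives the odd ones.
-/
theorem moments_real_of_form_real {Λ : ℂ[X] →ₗ[ℂ] ℂ}
    (h : ∀ u : ℂ[X], (Λ (u * conjPoly u)).im = 0) (k : ℕ) : (Λ (X ^ k)).im = 0 := by
  have hX : ∀ j : ℕ, conjPoly (X ^ j) = X ^ j := fun j => by simp [conjPoly]
  have heven : ∀ j : ℕ, (Λ (X ^ (2 * j))).im = 0 := fun j => by
    have := h (X ^ j)
    rwa [hX, ← pow_add, ← two_mul] at this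
  rcases Nat.even_or_odd' k with ⟨j, rfl | rfl⟩
  · exact heven j
  · have h1 := h (X ^ j + X ^ (j + 1))
    have h2 : (X ^ j + X ^ (j + 1) : ℂ[X]) * conjPoly (X ^ j + X ^ (j + 1)) =
        X ^ (2 * j) + (2 : ℂ) • X ^ (2 * j + 1) + X ^ (2 * (j + 1)) := by
      rw [conjPoly_add, hX, hX, two_smul]
      ring
    rw [h2, map_add, map_add, map_smul, Complex.add_im, Complex.add_im, heven, heven,
      smul_eq_mul] at h1
    simpa using h1

/-- Sign count for a perturbation of the Carleman operator by a symbol whose moment functional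
splits into jets at finitely many nodes. -/
theorem negative_spectrum_of_nodal {ι : Type*} [Fintype ι] {β : ι → ℂ} {K : ι → ℕ} {c : ι → ℂ}
    {L : ι → ℂ[X] →ₗ[ℂ] ℂ} {r : ℂ → ℂ}
    (hr : Continuous fun t : UnitAddCircle => r (circleVal t))
    (hβ : Function.Injective β) (hc : ∀ i, c i ≠ 0)
    (hL : ∀ i f, L i ((X - C (β i)) ^ K i * f) = c i * f.eval (β i))
    (hsum : ∀ f, ∑ i, L i f = ∫ t : UnitAddCircle, r (circleVal t) * f.eval (circleVal (-t))
      ∂AddCircle.haarAddCircle)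
    {G : hardySpace →L[ℂ] hardySpace}
    (hG : IsHankelOperator G fun μ => carlemanSymbol μ + r (μ : ℂ)) (hG_sa : IsSelfAdjoint G) :
    (∀ t : ℝ, t < 0 → (t : ℂ) ∈ spectrum ℂ G →
      Module.End.HasEigenvalue (G : hardySpace →ₗ[ℂ] hardySpace) (t : ℂ)) ∧
    Module.rank ℂ (negEigenspace G) = ((∑ i, negMultiplicity β K c i : ℕ) : Cardinal) := by
  have hri := hr.integrable_haarAddCircle
  have hint := hG.memLp_symbol.integrable le_top
  -- Obtained by subtracting the continuous `r` from the bounded total symbol.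
  have hci : Integrable (fun t : UnitAddCircle => carlemanSymbol (AddCircle.toCircle t))
      AddCircle.haarAddCircle := by
    refine (hint.sub hri).congr (Filter.Eventually.of_forall fun t => ?_)
    simp [circleVal]
  have hform0 : ∀ u : ℂ[X], inner ℂ (polyToHardy u) (G (polyToHardy u)) =
      (∫ x in (-1 : ℝ)..1, (u * conjPoly u).eval (x : ℂ)) + ∑ i, L i (u * conjPoly u) := by
    intro u
    rw [inner_polyToHardy hG, hsum, ← integral_carlemanSymbol_mul_eval hci,
      ← integral_add (integrable_mul_eval hci _) (integrable_mul_eval hri _)]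
    congr 1
    ext t
    exact add_mul _ _ _
  have hcarl : ∀ u : ℂ[X], ∫ x in (-1 : ℝ)..1, (u * conjPoly u).eval (x : ℂ) =
      ((∫ x in (-1 : ℝ)..1, ‖u.eval (x : ℂ)‖ ^ 2 : ℝ) : ℂ) := by
    intro u
    rw [← intervalIntegral.integral_ofReal]
    congr 1
    ext x
    exact eval_mul_conjPoly_of_real u (Complex.ofReal_im x)
  have hform : ∀ u : ℂ[X], (inner ℂ (polyToHardy u) (G (polyToHardy u))).re =
      (∑ i, L i (u * conjPoly u)).re + ∫ x in (-1 : ℝ)..1, ‖u.eval (x : ℂ)‖ ^ 2 := by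
    intro u
    rw [hform0, hcarl, Complex.add_re, Complex.ofReal_re, add_comm]
  have hreal : ∀ u : ℂ[X], ((∑ i, L i) (u * conjPoly u)).im = 0 := by
    intro u
    have h1 : (inner ℂ (polyToHardy u) (G (polyToHardy u))).im = 0 :=
      hG_sa.isSymmetric.im_inner_self_apply (polyToHardy u)
    rw [hform0, hcarl, Complex.add_im, Complex.ofReal_im, zero_add] at h1
    rwa [LinearMap.sum_apply]
  have h : IsNodalFunctional β K c L :=
    ⟨hβ, hc, hL, fun f => by
      have := map_conjPoly_of_moments_real (moments_real_of_form_real hreal) f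
      rwa [LinearMap.sum_apply, LinearMap.sum_apply] at this⟩
  set p := nodePoly β (negMultiplicity β K c)
  have hpm : p.Monic := monic_nodePoly _ _
  have hpd : p.natDegree = ∑ i, negMultiplicity β K c i := natDegree_nodePoly _ _
  set N := ∑ i, negMultiplicity β K c i
  obtain ⟨n, V, g, hV, hneg⟩ := h.exists_polyComb_neg
  set Φ : V →ₗ[ℂ] hardySpace := (polyToHardy ∘ₗ polyComb g) ∘ₗ V.subtype
  have hΦneg : ∀ x : V, x ≠ 0 → (inner ℂ (Φ x) (G (Φ x))).re < 0 := fun x hx => by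
    have := hneg x x.2 (fun h0 => hx (Subtype.ext h0))
    rw [← hform] at this
    exact this
  have hΦ : Function.Injective Φ := by
    rw [← LinearMap.ker_eq_bot, LinearMap.ker_eq_bot']
    intro x hx
    by_contra h0
    have := hΦneg x h0
    rw [hx] at this
    simp at this
  -- `D` consists of the multiples of `p` and `F` of the remainders modulo `p`; together they
  -- contain all polynomials.
  set D : Submodule ℂ hardySpace :=
    (LinearMap.range (LinearMap.mulLeft ℂ p)).map polyToHardy
  set F : Submodule ℂ hardySpace := (degreeLT ℂ N).map polyToHardy
  have : FiniteDimensional ℂ (degreeLT ℂ N) :=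
    Module.Finite.equiv (degreeLTEquiv ℂ N).symm
  refine negative_spectrum_of_dense_sup (D := D) (F := F) (W := LinearMap.range Φ) hG_sa
    ?_ ?_ ?_ ?_ ?_
  · have hDF : LinearMap.range polyToHardy ≤ D ⊔ F := by
      rintro _ ⟨u, rfl⟩
      rw [← modByMonic_add_div u p, map_add, add_comm]
      refine Submodule.add_mem_sup ⟨_, ⟨u /ₘ p, rfl⟩, rfl⟩ ⟨_, ?_, rfl⟩
      rw [SetLike.mem_coe, mem_degreeLT, ← hpd, ← degree_eq_natDegree hpm.ne_zero]
      exact degree_modByMonic_lt u hpm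
    exact le_bot_iff.1 ((Submodule.orthogonal_le hDF).trans range_polyToHardy_orthogonal.le)
  · rintro _ ⟨_, ⟨v, rfl⟩, rfl⟩
    rw [hform]
    have h1 := h.re_nonneg_of_negMultiplicity (u := p * v) (dvd_mul_right _ _)
    have h2 : 0 ≤ ∫ x in (-1 : ℝ)..1, ‖(p * v).eval (x : ℂ)‖ ^ 2 :=
      intervalIntegral.integral_nonneg (by norm_num) fun x _ => by positivity
    exact add_nonneg h1 h2
  · rintro _ ⟨x, rfl⟩ hx
    exact hΦneg x fun h0 => hx (by rw [h0, map_zero])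
  · refine (Submodule.finrank_map_le _ _).trans ?_
    rw [(degreeLTEquiv ℂ N).finrank_eq, Module.finrank_fin_fun]
  · rwa [LinearMap.finrank_range_of_inj hΦ]

end SignCount

/-! ### Translation from nodes to poles -/

section RationalSymbol

open Polynomial

theorem negCount_congr {K : ℕ} {p p' : ℝ} (h : ¬Odd K → (0 < p ↔ 0 < p')) :
    negCount K p = negCount K p' := by
  unfold negCount
  by_cases hK : Odd K
  · rw [if_pos hK, if_pos hK]
  · rw [if_neg hK, if_neg hK]
    exact if_congr (h hK) rfl rfl

theorem negCount_iterate_derivative (R : ℂ[X]) :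
    negCount R.natDegree ((derivative^[R.natDegree] R).eval 0).re =
      negCount R.natDegree (R.coeff R.natDegree).re := by
  refine negCount_congr fun _ => ?_
  rw [← coeff_zero_eq_eval_zero, coeff_iterate_derivative, zero_add, nsmul_eq_mul,
    Nat.descFactorial_self, ← Complex.ofReal_natCast, Complex.re_ofReal_mul]
  exact mul_pos_iff_of_pos_left (by exact_mod_cast Nat.factorial_pos _)

/-- Only even `K` matters: then the power is positive and `-γ⁻¹` has the sign of `-γ`. -/
theorem negCount_pole {γ : ℂ} (hγ : γ.im = 0) (hγ0 : γ ≠ 0) (K : ℕ) (z : ℂ) :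
    negCount K ((-(γ⁻¹) ^ 2) ^ K * (-γ⁻¹) * z).re = negCount K (-z.re * Real.sign γ.re) := by
  refine negCount_congr fun hK => ?_
  obtain ⟨g, rfl⟩ : ∃ g : ℝ, γ = g := ⟨γ.re, Complex.ext rfl hγ⟩
  have hg : g ≠ 0 := by exact_mod_cast hγ0
  have h1 : (-((g : ℂ)⁻¹) ^ 2) ^ K * (-(g : ℂ)⁻¹) * z =
      ((((g⁻¹) ^ 2) ^ K : ℝ) : ℂ) * (((-g⁻¹ : ℝ) : ℂ) * z) := by
    rw [(Nat.not_odd_iff_even.1 hK).neg_pow]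
    push_cast
    ring
  rw [h1, Complex.re_ofReal_mul, Complex.re_ofReal_mul, mul_pos_iff_of_pos_left (by positivity),
    Complex.ofReal_re]
  rcases lt_or_gt_of_ne hg with h | h
  · rw [Real.sign_of_neg h, mul_neg_one, neg_neg]
    exact mul_pos_iff_of_pos_left (neg_pos.2 (inv_lt_zero.2 h))
  · rw [Real.sign_of_pos h, mul_one, neg_mul, neg_pos, neg_pos]
    exact ⟨fun h' => neg_of_mul_neg_right h' (inv_pos.2 h).le,
      fun h' => mul_neg_of_pos_of_neg (inv_pos.2 h) h'⟩

/-- The leading coefficient of the jet at `γ⁻¹` which corresponds to the pole at `γ`. -/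
noncomputable def poleCoeff {n : ℕ} (γ : Fin n → ℂ) (K : Fin n → ℕ) (R : Fin n → ℂ[X])
    (m : Fin n) : ℂ :=
  (-(γ m)⁻¹ ^ 2) ^ K m * (-(γ m)⁻¹) * (R m).eval (γ m)

/-- Inversion exchanges the half-planes: nodes counted above the real axis are poles below it. -/
theorem negMultiplicity_pole {n : ℕ} {γ : Fin n → ℂ} {m : Fin n} (hγ : γ m ≠ 0) (K : Fin n → ℕ)
    (R : Fin n → ℂ[X]) :
    negMultiplicity (fun m => (γ m)⁻¹) K (poleCoeff γ K R) m =
      if (γ m).im = 0 then negCount (K m) (-((R m).eval (γ m)).re * Real.sign (γ m).re)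
      else if (γ m).im < 0 then K m + 1 else 0 := by
  have hn : 0 < Complex.normSq (γ m) := Complex.normSq_pos.2 hγ
  have h0 : ((γ m)⁻¹).im = 0 ↔ (γ m).im = 0 := by
    rw [Complex.inv_im, div_eq_zero_iff, neg_eq_zero, or_iff_left hn.ne']
  have hpos : 0 < ((γ m)⁻¹).im ↔ (γ m).im < 0 := by
    rw [Complex.inv_im, div_pos_iff_of_pos_right hn, neg_pos]
  unfold negMultiplicity
  simp only [h0, hpos]
  by_cases h : (γ m).im = 0
  · rw [if_pos h, if_pos h]
    exact negCount_pole h hγ _ _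
  · rw [if_neg h, if_neg h]

theorem sum_negMultiplicity_pole {n : ℕ} {γ : Fin n → ℂ} (hγ : ∀ m, γ m ≠ 0) (K : Fin n → ℕ)
    (R : Fin n → ℂ[X]) :
    ∑ m, negMultiplicity (fun m => (γ m)⁻¹) K (poleCoeff γ K R) m =
      ∑ m with (γ m).im = 0, negCount (K m) (-((R m).eval (γ m)).re * Real.sign (γ m).re) +
        ∑ m with (γ m).im < 0, K m + (Finset.univ.filter fun m => (γ m).im < 0).card := by
  rw [Finset.sum_filter, Finset.sum_filter, Finset.card_filter, ← Finset.sum_add_distrib,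
    ← Finset.sum_add_distrib]
  refine Finset.sum_congr rfl fun m _ => ?_
  rw [negMultiplicity_pole (hγ m)]
  by_cases h : (γ m).im = 0
  · simp [h]
  · by_cases h' : (γ m).im < 0 <;> simp [h, h']

end RationalSymbol

theorem theorem5p4 (R₁ : Polynomial ℂ) (n : ℕ) (γ : Fin n → ℂ) (K : Fin n → ℕ)
    (R : Fin n → Polynomial ℂ)
    (hγ_inj : Function.Injective γ)
    (hγ : ∀ m, 1 < ‖γ m‖)
    (hR_deg : ∀ m, (R m).natDegree ≤ K m)
    (hR_ne : ∀ m, (R m).eval (γ m) ≠ 0)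
    (G : hardySpace →L[ℂ] hardySpace)
    (hG : IsHankelOperator G fun μ => carlemanSymbol μ + rationalSymbol R₁ γ K R (μ : ℂ))
    (hG_sa : IsSelfAdjoint G) :
    (∀ t : ℝ, t < 0 → (t : ℂ) ∈ spectrum ℂ G →
      Module.End.HasEigenvalue (G : hardySpace →ₗ[ℂ] hardySpace) (t : ℂ)) ∧
    Module.rank ℂ (negEigenspace G) =
      (((if R₁ = 0 then 0 else
            negCount R₁.natDegree ((Polynomial.derivative^[R₁.natDegree] R₁).eval 0).re) +
          ∑ m with (γ m).im = 0,
            negCount (K m) (-((R m).eval (γ m)).re * Real.sign (γ m).re) +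
          ∑ m with (γ m).im < 0, K m +
          (Finset.univ.filter fun m => (γ m).im < 0).card : ℕ) : Cardinal) := by
  have hγ0 : ∀ m, γ m ≠ 0 := fun m h => by
    have := hγ m
    rw [h, norm_zero] at this
    linarith
  have hR₁c : Continuous fun t : UnitAddCircle => R₁.eval (circleVal t) :=
    R₁.continuous.comp continuous_circleVal
  have hpc : ∀ m, Continuous fun t : UnitAddCircle =>
      (R m).eval (circleVal t) / (circleVal t - γ m) ^ (K m + 1) :=
    fun m => continuous_pole (hγ m) (R m) (K m + 1)
  have hrc : Continuous fun t : UnitAddCircle => rationalSymbol R₁ γ K R (circleVal t) :=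
    hR₁c.add (continuous_finsetSum _ fun m _ => hpc m)
  set L₁ := circleFunctional _ hR₁c.integrable_haarAddCircle
  set L := fun m => circleFunctional _ (hpc m).integrable_haarAddCircle
  have hL₁ : ∀ f, L₁ ((Polynomial.X - Polynomial.C 0) ^ R₁.natDegree * f) =
      R₁.coeff R₁.natDegree * f.eval 0 := fun f => by
    rw [map_zero, sub_zero]
    exact integral_eval_mul_pow_mul_eval _ R₁ f le_rfl
  have hL : ∀ m f, L m ((Polynomial.X - Polynomial.C (γ m)⁻¹) ^ K m * f) =
      poleCoeff γ K R m * f.eval (γ m)⁻¹ :=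
    fun m f => integral_pole_mul_eval (hγ m) (K m) (R m) f (hR_deg m)
  have hcoeff : ∀ m, poleCoeff γ K R m ≠ 0 := fun m =>
    mul_ne_zero (mul_ne_zero (pow_ne_zero _ (neg_ne_zero.2 (pow_ne_zero _ (inv_ne_zero (hγ0 m)))))
      (neg_ne_zero.2 (inv_ne_zero (hγ0 m)))) (hR_ne m)
  have hsum : ∀ f : Polynomial ℂ, ∫ t : UnitAddCircle,
      rationalSymbol R₁ γ K R (circleVal t) * f.eval (circleVal (-t)) ∂AddCircle.haarAddCircle =
      L₁ f + ∑ m, L m f := fun f => by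
    have h1 : ∀ t : UnitAddCircle,
        rationalSymbol R₁ γ K R (circleVal t) * f.eval (circleVal (-t)) =
        R₁.eval (circleVal t) * f.eval (circleVal (-t)) +
          ∑ m, (R m).eval (circleVal t) / (circleVal t - γ m) ^ (K m + 1) *
            f.eval (circleVal (-t)) := fun t => by
      rw [rationalSymbol, add_mul, Finset.sum_mul]
    have hi : ∀ m, Integrable (fun t : UnitAddCircle =>
        (R m).eval (circleVal t) / (circleVal t - γ m) ^ (K m + 1) * f.eval (circleVal (-t)))
        AddCircle.haarAddCircle := fun m =>
      integrable_mul_eval (hpc m).integrable_haarAddCircle f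
    simp_rw [h1]
    rw [integral_add (integrable_mul_eval hR₁c.integrable_haarAddCircle f)
      (integrable_finsetSum _ fun m _ => hi m), integral_finsetSum _ fun m _ => hi m]
    rfl
  have hinj : Function.Injective fun m => (γ m)⁻¹ := fun m m' h => hγ_inj (inv_injective h)
  -- If `R₁ = 0`, a node at `0` would have zero leading coefficient and must be left out. Otherwise
  -- it is adjoined as `none`, distinct from every `(γ m)⁻¹`.
  by_cases hR₁ : R₁ = 0
  · have hL₁0 : ∀ f, L₁ f = 0 := fun f => by
      change ∫ t : UnitAddCircle, R₁.eval (circleVal t) * f.eval (circleVal (-t))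
        ∂AddCircle.haarAddCircle = 0
      simp [hR₁]
    have := negative_spectrum_of_nodal hrc hinj hcoeff hL
      (fun f => by rw [hsum, hL₁0, zero_add]) hG hG_sa
    rw [sum_negMultiplicity_pole hγ0] at this
    rw [if_pos hR₁, zero_add]
    exact this
  · have := negative_spectrum_of_nodal (ι := Option (Fin n))
      (β := fun i => i.elim 0 fun m => (γ m)⁻¹) (K := fun i => i.elim R₁.natDegree K)
      (c := fun i => i.elim (R₁.coeff R₁.natDegree) (poleCoeff γ K R))
      (L := fun i => i.elim L₁ L) hrc
      (by
        rintro (_ | m) (_ | m') h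
        · rfl
        · exact absurd h.symm (inv_ne_zero (hγ0 m'))
        · exact absurd h (inv_ne_zero (hγ0 m))
        · exact congrArg some (hinj h))
      (by
        rintro (_ | m)
        · exact Polynomial.leadingCoeff_ne_zero.2 hR₁
        · exact hcoeff m)
      (by
        rintro (_ | m) f
        · exact hL₁ f
        · exact hL m f)
      (fun f => by rw [hsum, Fintype.sum_option]; rfl) hG hG_sa
    rw [Fintype.sum_option] at this
    have hnone : negMultiplicity (fun i : Option (Fin n) => i.elim 0 fun m => (γ m)⁻¹)
        (fun i => i.elim R₁.natDegree K)
        (fun i => i.elim (R₁.coeff R₁.natDegree) (poleCoeff γ K R)) none =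
        negCount R₁.natDegree ((Polynomial.derivative^[R₁.natDegree] R₁).eval 0).re := by
      rw [negCount_iterate_derivative]
      exact if_pos Complex.zero_im
    have hsome : ∀ m, negMultiplicity (fun i : Option (Fin n) => i.elim 0 fun m => (γ m)⁻¹)
        (fun i => i.elim R₁.natDegree K)
        (fun i => i.elim (R₁.coeff R₁.natDegree) (poleCoeff γ K R)) (some m) =
        negMultiplicity (fun m => (γ m)⁻¹) K (poleCoeff γ K R) m := fun m => rfl
    simp only [hnone, hsome] at this
    rw [sum_negMultiplicity_pole hγ0, ← add_assoc, ← add_assoc] at this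
    rw [if_neg hR₁]
    exact this
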